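/- Let $v$ be an indeterminate, $n\ge 2$, and let $\dot{\mathbf U}(\mathfrak{gl}_n)$ be the modified quantum group over $\mathbb Q(v)$, with idempotents $1_\lambda$ ($\lambda\in\mathbb Z^n$) and divided powers $E_i^{(a)}1_\lambda$, $F_i^{(a)}1_\lambda$ ($1\le i\le n-1$). Let $[A]$ denote its Beilinson–Lusztig–MacPherson standard basis and $\{A\}$ its BLM (stably canonical) basis, both indexed by the integer $n\times n$ matrices $A$ with nonnegative off-diagonal entries: $\{A\}$ is the unique bar-invariant element of the form $[A]+\sum_{B<A}c_B[B]$ with $c_B\in v^{-1}\mathbb Z[v^{-1}]$, where $<$ is the BLM partial order. For $\lambda\in\mathbb Z^n$ let $L(\lambda)$ be the simple $\dot{\mathbf U}(\mathfrak{gl}_n)$-module of highest weight $\lambda$, with highest weight vector $u_\lambda^+$. For $m\in\mathbb Z$ put $[m]=\dfrac{v^{2m}-1}{v^2-1}$. (1) For every $n\ge 2$ there exist a dominant integral weight $\lambda$ and a BLM basis element $C\in\dot{\mathbf U}(\mathfrak{gl}_n)$ such that $Cu_\lambda^+$ is neither zero nor an element of the canonical basis of $L(\lambda)$. (2) Let $n=2$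 and let $a_{21},a_{22},p$ be integers with $a_{21}\ge 1$, $a_{22}\le -2$, $p\le 0$. Then $\lambda=(p+a_{21},\,a_{22}+p+1)$ is dominant, and $$\left\{\begin{matrix}p&1\\ a_{21}&a_{22}+p\end{matrix}\right\}u_\lambda^+ \;=\; v^{a_{22}+2p+3}\,[-a_{22}-2p-2]\;F^{(a_{21}-1)}u_\lambda^+ ,$$ where the coefficient is the bar-invariant quantum integer $\dfrac{v^{k}-v^{-k}}{v-v^{-1}}$ with $k=-a_{22}-2p-2$. -/

import Mathlib

open scoped nonZeroDivisors

/-! ## The ground field `ℚ(v)` -/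

namespace QuantumGL

noncomputable section

/-- The field `ℚ(v)`. -/
abbrev Qv : Type := RatFunc ℚ

/-- The indeterminate `v`. -/
def v : Qv := RatFunc.X

lemma v_ne_zero : v ≠ 0 := RatFunc.X_ne_zero

lemma v_sq_ne_one : v ^ 2 ≠ 1 := by
  intro h
  have h1 : (algebraMap (Polynomial ℚ) Qv) (Polynomial.X ^ 2) = algebraMap (Polynomial ℚ) Qv 1 := by
    simpa [v] using h
  have h2 := congrArg Polynomial.natDegree (RatFunc.algebraMap_injective ℚ h1)
  simp at h2

lemma barRat_aux (K : Type) [Field K] : (Polynomial K)⁰ ≤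
    ((RatFunc K)⁰).comap (Polynomial.aeval (R := K) (RatFunc.X : RatFunc K)⁻¹).toRingHom := by
  apply nonZeroDivisors_le_comap_nonZeroDivisors_of_injective
  have h : Transcendental K (RatFunc.X : RatFunc K)⁻¹ := fun hv =>
    RatFunc.transcendental_X (K := K) (IsAlgebraic.inv_iff.mp hv)
  exact transcendental_iff_injective.mp h

/-- The automorphism of `K(X)` over `K` that sends `X` to `X⁻¹`. -/
def barRat (K : Type) [Field K] : RatFunc K →+* RatFunc K :=
  RatFunc.liftRingHom (Polynomial.aeval (R := K) (RatFunc.X : RatFunc K)⁻¹).toRingHom (barRat_aux K)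

lemma barRat_X (K : Type) [Field K] : barRat K RatFunc.X = RatFunc.X⁻¹ := by
  have h := RatFunc.liftRingHom_apply_div'
    (Polynomial.aeval (R := K) (RatFunc.X : RatFunc K)⁻¹).toRingHom (barRat_aux K) Polynomial.X 1
  simpa [barRat] using h

/-- The field automorphism `v ↦ v⁻¹` of `ℚ(v)`. -/
def barQ : Qv →+* Qv := barRat ℚ

lemma barQ_v : barQ v = v⁻¹ := barRat_X ℚ

/-- The (not bar-invariant) quantum integer `[m] = (v^{2m} - 1) / (v² - 1)`, for `m ∈ ℤ`. -/
def br (m : ℤ) : Qv := (v ^ (2 * m) - 1) / (v ^ 2 - 1)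

/-- The bar-invariant quantum integer `(v^m - v^{-m}) / (v - v⁻¹)`, for `m ∈ ℤ`. -/
def qInt (m : ℤ) : Qv := (v ^ m - v ^ (-m)) / (v - v⁻¹)

/-- The bar-invariant quantum factorial. -/
def qFact (a : ℕ) : Qv := ∏ k ∈ Finset.range a, qInt (k + 1)

/-- The set `v⁻¹ ℤ[v⁻¹]`. -/
def vInvZ : Set Qv := {c | ∃ p : Polynomial ℤ, c = v⁻¹ * Polynomial.aeval (v⁻¹) p}

lemma barQ_qInt (m : ℤ) : barQ (qInt m) = qInt m := by
  simp only [qInt, map_div₀, map_sub, map_zpow₀, barQ_v, map_inv₀, inv_inv, inv_zpow', neg_neg]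
  rw [← neg_sub (v ^ m), ← neg_sub v, neg_div_neg_eq]

/-! ## The modified quantum group of `gl_n`, where `n = r + 1` -/

/-- Integral weights of `gl_{r+1}`. -/
abbrev Weight (r : ℕ) : Type := Fin (r + 1) → ℤ

/-- The simple root `ε_i - ε_{i+1}`. -/
def root {r : ℕ} (i : Fin r) : Weight r := Pi.single i.castSucc 1 - Pi.single i.succ 1

/-- Names of the generators `1_λ`, `E_i 1_λ`, `F_i 1_λ`. -/
inductive Gen (r : ℕ) : Type
  | one (wt : Weight r) : Gen r
  | E (i : Fin r) (wt : Weight r) : Gen r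
  | F (i : Fin r) (wt : Weight r) : Gen r

/-- The free unital algebra on the generators. -/
abbrev Free (r : ℕ) : Type := FreeAlgebra Qv (Gen r)

/-- The free generator `1_λ`. -/
def fone {r : ℕ} (wt : Weight r) : Free r := FreeAlgebra.ι Qv (Gen.one wt)
/-- The free generator `E_i 1_λ`. -/
def fE {r : ℕ} (i : Fin r) (wt : Weight r) : Free r := FreeAlgebra.ι Qv (Gen.E i wt)
/-- The free generator `F_i 1_λ`. -/
def fF {r : ℕ} (i : Fin r) (wt : Weight r) : Free r := FreeAlgebra.ι Qv (Gen.F i wt)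

/-- Two simple roots are joined in the Dynkin diagram. -/
def Joined {r : ℕ} (i j : Fin r) : Prop := (i : ℕ) + 1 = j ∨ (j : ℕ) + 1 = i

/-- The defining relations of the modified quantum group. -/
inductive Rel (r : ℕ) : Free r → Free r → Prop
  | one_one (wt : Weight r) : Rel r (fone wt * fone wt) (fone wt)
  | one_ne (wt wt' : Weight r) (h : wt ≠ wt') : Rel r (fone wt * fone wt') 0
  | one_E (i : Fin r) (wt : Weight r) : Rel r (fone (wt + root i) * fE i wt) (fE i wt)
  | E_one (i : Fin r) (wt : Weight r) : Rel r (fE i wt * fone wt) (fE i wt)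
  | one_F (i : Fin r) (wt : Weight r) : Rel r (fone (wt - root i) * fF i wt) (fF i wt)
  | F_one (i : Fin r) (wt : Weight r) : Rel r (fF i wt * fone wt) (fF i wt)
  | EF_same (i : Fin r) (wt : Weight r) :
      Rel r (fE i (wt - root i) * fF i wt)
        (fF i (wt + root i) * fE i wt + qInt (wt i.castSucc - wt i.succ) • fone wt)
  | EF_ne (i j : Fin r) (h : i ≠ j) (wt : Weight r) :
      Rel r (fE i (wt - root j) * fF j wt) (fF j (wt + root i) * fE i wt)
  | E_comm (i j : Fin r) (h : i ≠ j) (h' : ¬ Joined i j) (wt : Weight r) :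
      Rel r (fE i (wt + root j) * fE j wt) (fE j (wt + root i) * fE i wt)
  | F_comm (i j : Fin r) (h : i ≠ j) (h' : ¬ Joined i j) (wt : Weight r) :
      Rel r (fF i (wt - root j) * fF j wt) (fF j (wt - root i) * fF i wt)
  | E_serre (i j : Fin r) (h : Joined i j) (wt : Weight r) :
      Rel r (fE i (wt + root j + root i) * fE i (wt + root j) * fE j wt
          + fE j (wt + root i + root i) * fE i (wt + root i) * fE i wt)
        ((v + v⁻¹) • (fE i (wt + root i + root j) * fE j (wt + root i) * fE i wt))
  | F_serre (i j : Fin r) (h : Joined i j) (wt : Weight r) :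
      Rel r (fF i (wt - root j - root i) * fF i (wt - root j) * fF j wt
          + fF j (wt - root i - root i) * fF i (wt - root i) * fF i wt)
        ((v + v⁻¹) • (fF i (wt - root i - root j) * fF j (wt - root i) * fF i wt))

/-- The algebra presented by the generators and relations, with a unit adjoined: the modified
quantum group `U̇(gl_{r+1})` over `ℚ(v)` is the two-sided ideal spanned by the nonempty products of
generators, and `U r = ℚ(v) 1 ⊕ U̇(gl_{r+1})`. In particular `U r * 1_λ = U̇ 1_λ`. -/
abbrev U (r : ℕ) : Type := RingQuot (Rel r)

/-- The idempotent `1_λ`. -/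
def one {r : ℕ} (wt : Weight r) : U r := RingQuot.mkAlgHom Qv (Rel r) (fone wt)
/-- The element `E_i 1_λ`. -/
def E {r : ℕ} (i : Fin r) (wt : Weight r) : U r := RingQuot.mkAlgHom Qv (Rel r) (fE i wt)
/-- The element `F_i 1_λ`. -/
def F {r : ℕ} (i : Fin r) (wt : Weight r) : U r := RingQuot.mkAlgHom Qv (Rel r) (fF i wt)

/-- `E_i^a 1_λ`. -/
def powE {r : ℕ} (i : Fin r) : ℕ → Weight r → U r
  | 0, wt => one wt
  | a + 1, wt => E i (wt + (a : ℤ) • root i) * powE i a wt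

/-- `F_i^a 1_λ`. -/
def powF {r : ℕ} (i : Fin r) : ℕ → Weight r → U r
  | 0, wt => one wt
  | a + 1, wt => F i (wt - (a : ℤ) • root i) * powF i a wt

/-- The divided power `E_i^{(a)} 1_λ`. -/
def divE {r : ℕ} (i : Fin r) (a : ℕ) (wt : Weight r) : U r := (qFact a)⁻¹ • powE i a wt

/-- The divided power `F_i^{(a)} 1_λ`. -/
def divF {r : ℕ} (i : Fin r) (a : ℕ) (wt : Weight r) : U r := (qFact a)⁻¹ • powF i a wt

/-- `ℚ(v)` acting on `U r` through `v ↦ v⁻¹`. -/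
abbrev twistedAlgebra (r : ℕ) : Algebra Qv (U r) :=
  ((algebraMap Qv (U r)).comp barQ).toAlgebra' fun c x => Algebra.commutes (barQ c) x

/-- The map of free generators into `U r`, extended semilinearly. -/
def barFree (r : ℕ) : Free r →+* U r :=
  letI := twistedAlgebra r
  (FreeAlgebra.lift Qv (fun g : Gen r =>
    RingQuot.mkAlgHom Qv (Rel r) (FreeAlgebra.ι Qv g) : Gen r → U r)).toRingHom

lemma barFree_gen (r : ℕ) (g : Gen r) :
    barFree r (FreeAlgebra.ι Qv g) = RingQuot.mkAlgHom Qv (Rel r) (FreeAlgebra.ι Qv g) := by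
  let _ := twistedAlgebra r
  exact FreeAlgebra.lift_ι_apply _ g

lemma barFree_smul (r : ℕ) (c : Qv) (x : Free r) :
    barFree r (c • x) = barQ c • barFree r x := by
  have h : barFree r (algebraMap Qv (Free r) c) = algebraMap Qv (U r) (barQ c) := by
    let _ := twistedAlgebra r
    exact AlgHom.commutes (FreeAlgebra.lift Qv (fun g : Gen r =>
      RingQuot.mkAlgHom Qv (Rel r) (FreeAlgebra.ι Qv g) : Gen r → U r)) c
  rw [Algebra.smul_def, map_mul, h, ← Algebra.smul_def]

lemma barFree_rel (r : ℕ) ⦃x y : Free r⦄ (h : Rel r x y) :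
    barFree r x = barFree r y := by
  have h1 := RingQuot.mkAlgHom_rel Qv h
  have hv : barQ (v + v⁻¹) = v + v⁻¹ := by
    rw [map_add, map_inv₀, barQ_v, inv_inv, add_comm]
  cases h <;>
    simpa [fone, fE, fF, barFree_gen, barFree_smul, barQ_qInt, hv, map_smul, -map_add,
      map_add (barFree r), map_add (RingQuot.mkAlgHom Qv (Rel r))] using h1

/-- The bar involution: the ring endomorphism with `v ↦ v⁻¹` that fixes every generator. -/
def bar (r : ℕ) : U r →+* U r := RingQuot.lift ⟨barFree r, barFree_rel r⟩

lemma bar_gen (r : ℕ) (g : Gen r) :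
    bar r (RingQuot.mkAlgHom Qv (Rel r) (FreeAlgebra.ι Qv g))
      = RingQuot.mkAlgHom Qv (Rel r) (FreeAlgebra.ι Qv g) := by
  have h := RingQuot.lift_mkRingHom_apply (barFree r) (barFree_rel r) (FreeAlgebra.ι Qv g)
  rw [barFree_gen, ← RingQuot.mkAlgHom_coe Qv (Rel r)] at h
  exact h

/-! ## Standard basis coordinates -/

/-- Integer matrices whose off-diagonal entries are nonnegative. -/
def InTheta {n : ℕ} (M : Matrix (Fin n) (Fin n) ℤ) : Prop := ∀ i j, i ≠ j → 0 ≤ M i j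

/-- The index set of the standard basis. -/
abbrev Theta (n : ℕ) : Type := {M : Matrix (Fin n) (Fin n) ℤ // InTheta M}

/-- Row sums. -/
def ro {n : ℕ} (M : Matrix (Fin n) (Fin n) ℤ) : Fin n → ℤ := fun i => ∑ j, M i j

/-- Column sums. -/
def co {n : ℕ} (M : Matrix (Fin n) (Fin n) ℤ) : Fin n → ℤ := fun j => ∑ i, M i j

/-- The space with basis the symbols `[A]`. -/
abbrev V (n : ℕ) : Type := Theta n →₀ Qv

open Classical in
/-- The symbol `[M]`, read as `0` if an off-diagonal entry of `M` is negative. -/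
def std {n : ℕ} (M : Matrix (Fin n) (Fin n) ℤ) : V n :=
  if h : InTheta M then Finsupp.single ⟨M, h⟩ 1 else 0

/-- The matrix `E_{ku} - E_{lu}`. -/
def shift {n : ℕ} (k l u : Fin n) : Matrix (Fin n) (Fin n) ℤ :=
  Matrix.single k u 1 - Matrix.single l u 1

/-- The coefficient of `[A + E_{ku} - E_{lu}]` in the multiplication formula; `T u` is the set of
columns to the right (or to the left) of `u`. -/
def moveCoeff {n : ℕ} (k l : Fin n) (T : Fin n → Finset (Fin n))
    (A : Matrix (Fin n) (Fin n) ℤ) (u : Fin n) : Qv :=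
  v ^ (A k u + ∑ j ∈ T u, A k j - ∑ j ∈ T u, A l j) * barQ (br (A k u + 1))

/-- The operator `[A] ↦ ∑_u v^{a_{ku} + ∑_{j ∈ T u} (a_{kj} - a_{lj})} \bar{[a_{ku} + 1]}
[A + E_{ku} - E_{lu}]`. -/
def moveOp {n : ℕ} (k l : Fin n) (T : Fin n → Finset (Fin n)) : Module.End Qv (V n) :=
  Finsupp.linearCombination Qv fun A : Theta n =>
    ∑ u, moveCoeff k l T A.1 u • std (A.1 + shift k l u)

open Classical in
/-- The projection onto the span of the `[A]` with row sums `wt`. -/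
def rowProj {n : ℕ} (wt : Fin n → ℤ) : Module.End Qv (V n) :=
  Finsupp.linearCombination Qv fun A : Theta n => if ro A.1 = wt then std A.1 else 0

/-- Left multiplication by the generators on the symbols `[A]`:
`1_λ [A] = δ_{λ, ro(A)} [A]`, and, if `ro(A) = λ`,
`E_h 1_λ [A] = ∑_u v^{∑_{j ≥ u} a_{hj} - ∑_{j > u} a_{h+1,j}} \bar{[a_{hu} + 1]}
[A + E_{hu} - E_{h+1,u}]`,
`F_h 1_λ [A] = ∑_u v^{∑_{j ≤ u} a_{h+1,j} - ∑_{j < u} a_{hj}} \bar{[a_{h+1,u} + 1]}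
[A - E_{hu} + E_{h+1,u}]`. -/
def genOp {r : ℕ} : Gen r → Module.End Qv (V (r + 1))
  | .one wt => rowProj wt
  | .E i wt => moveOp i.castSucc i.succ Finset.Ioi * rowProj wt
  | .F i wt => moveOp i.succ i.castSucc Finset.Iio * rowProj wt

section Action

variable {n : ℕ}

/-- The exponent contributed by the columns in `T u`. -/
def tail (k l : Fin n) (T : Fin n → Finset (Fin n)) (M : Matrix (Fin n) (Fin n) ℤ)
    (u : Fin n) : ℤ := ∑ j ∈ T u, (M k j - M l j)

lemma barQ_br (m : ℤ) : v ^ (m - 1) * barQ (br m) = qInt m := by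
  have h0 := v_ne_zero
  have h1 : v ^ 2 - 1 ≠ 0 := sub_ne_zero.mpr v_sq_ne_one
  have h2 : (v⁻¹) ^ 2 - 1 ≠ 0 := by
    intro h
    apply h1
    field_simp at h
    linear_combination -h
  have h3 : v - v⁻¹ ≠ 0 := by
    intro h
    apply h1
    field_simp at h
    linear_combination h
  simp only [br, qInt, map_div₀, map_sub, map_zpow₀, map_pow, barQ_v, map_one]
  rw [zpow_sub₀ h0, zpow_one, inv_zpow', two_mul, neg_add, zpow_add₀ h0, zpow_neg]
  have h4 : v ^ m ≠ 0 := zpow_ne_zero _ h0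
  have h5 : (1 - v ^ 2) ≠ 0 := by
    intro h
    apply h1
    linear_combination -h
  field_simp
  ring

lemma moveCoeff_eq (k l : Fin n) (T : Fin n → Finset (Fin n)) (M : Matrix (Fin n) (Fin n) ℤ)
    (u : Fin n) : moveCoeff k l T M u = v ^ tail k l T M u * qInt (M k u + 1) := by
  rw [moveCoeff, ← barQ_br, ← mul_assoc, ← zpow_add₀ v_ne_zero, tail, Finset.sum_sub_distrib]
  congr 2
  ring

lemma shift_apply (k l u i j : Fin n) :
    shift k l u i j = if u = j then (if k = i then 1 else 0) - (if l = i then 1 else 0) else 0 := by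
  by_cases h : u = j <;> simp [shift, Matrix.single_apply, h]

lemma tail_add_shift (k l : Fin n) (T : Fin n → Finset (Fin n))
    (M : Matrix (Fin n) (Fin n) ℤ) (u k' l' w : Fin n) :
    tail k l T (M + shift k' l' w) u = tail k l T M u + if w ∈ T u then
      ((if k' = k then 1 else 0) - (if l' = k then 1 else 0)
        - (if k' = l then 1 else 0) + (if l' = l then 1 else 0)) else 0 := by
  have h : ∀ j, (M + shift k' l' w) k j - (M + shift k' l' w) l j = (M k j - M l j)
      + if w = j then ((if k' = k then 1 else 0) - (if l' = k then 1 else 0)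
        - (if k' = l then 1 else 0) + (if l' = l then 1 else 0)) else 0 := by
    intro j
    rw [Matrix.add_apply, Matrix.add_apply, shift_apply, shift_apply]
    split_ifs <;> ring
  rw [tail, Finset.sum_congr rfl fun j _ => h j, Finset.sum_add_distrib, tail,
    Finset.sum_ite_eq]

lemma std_of_mem (A : Theta n) : std A.1 = Finsupp.single A 1 := by
  simp [std, A.2]

lemma end_ext {f g : Module.End Qv (V n)} (h : ∀ A : Theta n, f (std A.1) = g (std A.1)) :
    f = g := by
  refine Finsupp.lhom_ext fun A b => ?_
  have h1 : Finsupp.single A b = b • std A.1 := by simp [std_of_mem]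
  rw [h1, map_smul, map_smul, h]

lemma qInt_zero : qInt 0 = 0 := by simp [qInt]

lemma moveOp_std {k l : Fin n} (hkl : k ≠ l) (T : Fin n → Finset (Fin n))
    (M : Matrix (Fin n) (Fin n) ℤ) :
    moveOp k l T (std M) = ∑ u, moveCoeff k l T M u • std (M + shift k l u) := by
  by_cases h : InTheta M
  · have h1 := std_of_mem ⟨M, h⟩
    simp only at h1
    rw [h1, moveOp, Finsupp.linearCombination_single, one_smul]
  · rw [std, dif_neg h, map_zero]
    symm
    refine Finset.sum_eq_zero fun u _ => ?_
    by_cases h2 : InTheta (M + shift k l u)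
    · unfold InTheta at h
      push Not at h
      obtain ⟨i, j, hij, hneg⟩ := h
      have h3 := h2 i j hij
      rw [Matrix.add_apply, shift_apply] at h3
      have h4 : u = j ∧ k = i ∧ M i j = -1 := by
        split_ifs at h3 <;> simp_all <;> omega
      obtain ⟨rfl, rfl, h5⟩ := h4
      rw [moveCoeff_eq, h5]
      simp [qInt_zero]
    · rw [std, dif_neg h2, smul_zero]

lemma ro_add_shift (M : Matrix (Fin n) (Fin n) ℤ) (k l u : Fin n) :
    ro (M + shift k l u) = ro M + (Pi.single k 1 - Pi.single l 1) := by
  funext i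
  have h : ∀ j, (M + shift k l u) i j = M i j
      + if u = j then ((if k = i then 1 else 0) - (if l = i then 1 else 0)) else 0 := by
    intro j
    rw [Matrix.add_apply, shift_apply]
  simp only [ro, h, Finset.sum_add_distrib, Finset.sum_ite_eq, Finset.mem_univ, if_true,
    Pi.add_apply, Pi.sub_apply, Pi.single_apply, eq_comm (a := i)]

lemma rowProj_std (wt : Fin n → ℤ) (M : Matrix (Fin n) (Fin n) ℤ) :
    rowProj wt (std M) = if ro M = wt then std M else 0 := by
  by_cases h : InTheta M
  · have h1 := std_of_mem ⟨M, h⟩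
    simp only at h1
    rw [h1, rowProj, Finsupp.linearCombination_single, one_smul, ← h1]
  · simp [std, dif_neg h]

lemma rowProj_mul_self (wt : Fin n → ℤ) : rowProj (n := n) wt * rowProj wt = rowProj wt := by
  refine end_ext fun A => ?_
  rw [Module.End.mul_apply, rowProj_std]
  split_ifs with h <;> simp [rowProj_std, h]

lemma rowProj_mul_ne {wt wt' : Fin n → ℤ} (h : wt ≠ wt') :
    rowProj (n := n) wt * rowProj wt' = 0 := by
  refine end_ext fun A => ?_
  rw [Module.End.mul_apply, rowProj_std]
  split_ifs with h1
  · have h2 : ro A.1 ≠ wt := fun h3 => h (h3.symm.trans h1)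
    simp [rowProj_std, h2]
  · simp

lemma moveOp_rowProj {k l : Fin n} (hkl : k ≠ l) (T : Fin n → Finset (Fin n))
    {wt wt' : Fin n → ℤ} (h : wt' = wt + (Pi.single k 1 - Pi.single l 1)) :
    moveOp k l T * rowProj wt = rowProj wt' * moveOp k l T := by
  refine end_ext fun A => ?_
  rw [Module.End.mul_apply, Module.End.mul_apply, rowProj_std, moveOp_std hkl, map_sum]
  by_cases h1 : ro A.1 = wt
  · simp [h1, h, moveOp_std hkl, rowProj_std, ro_add_shift]
  · simp [h1, h, rowProj_std, ro_add_shift]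

lemma moveOp_moveOp {k l k' l' : Fin n} (hkl : k ≠ l) (hkl' : k' ≠ l')
    (T T' : Fin n → Finset (Fin n)) (M : Matrix (Fin n) (Fin n) ℤ) :
    (moveOp k l T * moveOp k' l' T') (std M) = ∑ u, ∑ w,
      (moveCoeff k' l' T' M w * moveCoeff k l T (M + shift k' l' w) u) •
        std (M + shift k' l' w + shift k l u) := by
  rw [Module.End.mul_apply, moveOp_std hkl', map_sum, Finset.sum_comm]
  refine Finset.sum_congr rfl fun w _ => ?_
  rw [map_smul, moveOp_std hkl, Finset.smul_sum]
  refine Finset.sum_congr rfl fun u _ => ?_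
  rw [smul_smul]

lemma moveOp_comm {k l k' l' : Fin n} (hkl : k ≠ l) (hkl' : k' ≠ l')
    {T T' : Fin n → Finset (Fin n)}
    (h : ∀ (M : Matrix (Fin n) (Fin n) ℤ) (u w : Fin n),
      moveCoeff k' l' T' M w * moveCoeff k l T (M + shift k' l' w) u
        = moveCoeff k l T M u * moveCoeff k' l' T' (M + shift k l u) w) :
    moveOp k l T * moveOp k' l' T' = moveOp k' l' T' * moveOp k l T := by
  refine end_ext fun A => ?_
  rw [moveOp_moveOp hkl hkl', moveOp_moveOp hkl' hkl, Finset.sum_comm]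
  refine Finset.sum_congr rfl fun w _ => Finset.sum_congr rfl fun u _ => ?_
  rw [h, add_right_comm]

lemma moveOp_comm_of_disjoint {k l k' l' : Fin n} (hkl : k ≠ l) (hkl' : k' ≠ l')
    (h1 : k ≠ k') (h2 : k ≠ l') (h3 : l ≠ k') (h4 : l ≠ l') (T T' : Fin n → Finset (Fin n)) :
    moveOp k l T * moveOp k' l' T' = moveOp k' l' T' * moveOp k l T := by
  refine moveOp_comm hkl hkl' fun M u w => ?_
  simp only [moveCoeff_eq, tail_add_shift, Matrix.add_apply, shift_apply, h1, h2, h3, h4,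
    h1.symm, h2.symm, h3.symm, h4.symm, if_false, sub_zero, add_zero, ite_self]
  ring

lemma moveOp_comm_opposite {k l k' l' : Fin n} (hkl : k ≠ l) (hkl' : k' ≠ l')
    (h1 : k ≠ k') (h4 : l ≠ l') :
    moveOp k l Finset.Ioi * moveOp l' k' Finset.Iio
      = moveOp l' k' Finset.Iio * moveOp k l Finset.Ioi := by
  refine moveOp_comm hkl hkl'.symm fun M u w => ?_
  have h0 := v_ne_zero
  simp only [moveCoeff_eq, tail_add_shift, Matrix.add_apply, shift_apply, h1, h4, h1.symm,
    h4.symm, Finset.mem_Ioi, Finset.mem_Iio, if_false]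
  rcases lt_trichotomy u w with h | rfl | h
  · have e1 := h.ne
    have e2 := h.ne'
    have e3 := h.not_gt
    by_cases a1 : k = l' <;> by_cases a2 : l = k' <;>
      simp [h, e1, e2, a1, a2, eq_comm, zpow_add₀ h0] <;> ring
  · by_cases a1 : k = l' <;> by_cases a2 : l = k' <;>
      simp [a1, a2, eq_comm, zpow_add₀ h0] <;> ring
  · have e1 := h.ne
    have e2 := h.ne'
    have e3 := h.not_gt
    by_cases a1 : k = l' <;> by_cases a2 : l = k' <;>
      simp [e3, e1, e2, a1, a2, eq_comm, zpow_add₀ h0] <;> ring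

lemma v_sub_inv_ne_zero : v - v⁻¹ ≠ 0 := by
  intro h
  have h0 := v_ne_zero
  apply v_sq_ne_one
  field_simp at h
  linear_combination h

lemma qInt_add (a b : ℤ) : v ^ b * qInt a + v ^ (-a) * qInt b = qInt (a + b) := by
  have h0 := v_ne_zero
  have h1 := v_sub_inv_ne_zero
  simp only [qInt, neg_add, zpow_add₀ h0, zpow_neg]
  have h2 : v ^ a ≠ 0 := zpow_ne_zero _ h0
  have h3 : v ^ b ≠ 0 := zpow_ne_zero _ h0
  field_simp
  ring

lemma sum_qInt (m : ℕ) (d : Fin m → ℤ) :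
    ∑ u, v ^ ((∑ j, if u < j then d j else 0) - ∑ j, if j < u then d j else 0) * qInt (d u)
      = qInt (∑ u, d u) := by
  induction m with
  | zero => simp [qInt_zero]
  | succ m ih =>
    rw [Fin.sum_univ_succ, Fin.sum_univ_succ (f := d), ← qInt_add, ← ih (fun j => d j.succ),
      Finset.mul_sum]
    congr 1
    · congr 2
      simp [Fin.sum_univ_succ]
    · refine Finset.sum_congr rfl fun u _ => ?_
      rw [← mul_assoc, ← zpow_add₀ v_ne_zero]
      congr 2
      simp [Fin.sum_univ_succ]
      ring

lemma EF_scalar {k l : Fin n} (hkl : k ≠ l) (M : Matrix (Fin n) (Fin n) ℤ) (u w : Fin n) :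
    moveCoeff l k Finset.Iio M w * moveCoeff k l Finset.Ioi (M + shift l k w) u
      = moveCoeff k l Finset.Ioi M u * moveCoeff l k Finset.Iio (M + shift k l u) w
        + if u = w then v ^ (tail k l Finset.Ioi M u - tail k l Finset.Iio M u)
            * qInt (M k u - M l u) else 0 := by
  have h0 := v_ne_zero
  have hv := v_sub_inv_ne_zero
  simp only [moveCoeff_eq, tail_add_shift, Matrix.add_apply, shift_apply, hkl, hkl.symm,
    Finset.mem_Ioi, Finset.mem_Iio, if_false]
  rcases lt_trichotomy u w with h | rfl | h
  · have e1 := h.ne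
    have e2 := h.ne'
    simp [h, e1, e2, zpow_add₀ h0]
    ring
  · have e : tail l k Finset.Iio M u = - tail k l Finset.Iio M u := by
      simp [tail]
    simp only [e, if_true, lt_irrefl, if_false, add_zero, sub_zero, zero_sub]
    rw [zpow_sub₀ h0, zpow_neg]
    have h1 : v ^ tail k l Finset.Iio M u ≠ 0 := zpow_ne_zero _ h0
    have key : ∀ a b : ℤ, qInt (b + 1) * qInt a = qInt (a + 1) * qInt b + qInt (a - b) := by
      intro a b
      have h2 : v ^ a ≠ 0 := zpow_ne_zero _ h0
      have h3 : v ^ b ≠ 0 := zpow_ne_zero _ h0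
      have h4 : v ^ 2 - 1 ≠ 0 := sub_ne_zero.mpr v_sq_ne_one
      have h5 : v - v⁻¹ = (v ^ 2 - 1) / v := by field_simp
      simp only [qInt, neg_add, neg_sub, zpow_add₀ h0, zpow_sub₀ h0, zpow_neg, zpow_one, h5]
      field_simp
      ring
    have k1 := key (M k u) (M l u)
    have e1 : M k u + -1 + 1 = M k u := by ring
    have e2 : M l u + -1 + 1 = M l u := by ring
    simp only [e1, e2]
    linear_combination (v ^ tail k l Finset.Ioi M u * (v ^ tail k l Finset.Iio M u)⁻¹) * k1
  · have e1 := h.ne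
    have e2 := h.ne'
    simp [h.not_gt, h, e1, e2, zpow_add₀ h0]
    ring

lemma moveOp_EF {k l : Fin n} (hkl : k ≠ l) (M : Matrix (Fin n) (Fin n) ℤ) :
    (moveOp k l Finset.Ioi * moveOp l k Finset.Iio) (std M)
      = (moveOp l k Finset.Iio * moveOp k l Finset.Ioi) (std M)
        + qInt (ro M k - ro M l) • std M := by
  have h1 : ∀ u w : Fin n, M + shift l k w + shift k l u = M + shift k l u + shift l k w :=
    fun u w => add_right_comm _ _ _
  have h2 : ∀ u : Fin n, M + shift k l u + shift l k u = M := by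
    intro u
    simp [shift]
    abel
  rw [moveOp_moveOp hkl hkl.symm, moveOp_moveOp hkl.symm hkl,
    Finset.sum_comm (γ := Fin n) (s := Finset.univ) (t := Finset.univ)
      (f := fun u w => (moveCoeff k l Finset.Ioi M w *
        moveCoeff l k Finset.Iio (M + shift k l w) u) • std (M + shift k l w + shift l k u))]
  have h3 : ∑ u, v ^ (tail k l Finset.Ioi M u - tail k l Finset.Iio M u)
      * qInt (M k u - M l u) = qInt (ro M k - ro M l) := by
    rw [ro, ro, ← Finset.sum_sub_distrib, ← sum_qInt n (fun j => M k j - M l j)]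
    refine Finset.sum_congr rfl fun u _ => ?_
    congr 3
    · rw [tail, ← Finset.sum_filter]
      congr 1
      ext j
      simp
    · rw [tail, ← Finset.sum_filter]
      congr 1
      ext j
      simp
  rw [← h3, Finset.sum_smul, ← Finset.sum_add_distrib]
  refine Finset.sum_congr rfl fun u _ => ?_
  have h4 : (v ^ (tail k l Finset.Ioi M u - tail k l Finset.Iio M u) * qInt (M k u - M l u))
      • std M = ∑ w, if u = w then (v ^ (tail k l Finset.Ioi M u - tail k l Finset.Iio M u)
        * qInt (M k u - M l u)) • std (M + shift k l u + shift l k w) else 0 := by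
    rw [Finset.sum_ite_eq]
    simp [h2]
  rw [h4, ← Finset.sum_add_distrib]
  refine Finset.sum_congr rfl fun w _ => ?_
  rw [EF_scalar hkl, h1, add_smul]
  congr 1
  split_ifs <;> simp

lemma three_moves {a a' b b' c c' : Fin n} (ha : a ≠ a') (hb : b ≠ b') (hc : c ≠ c')
    (T : Fin n → Finset (Fin n)) (M : Matrix (Fin n) (Fin n) ℤ) :
    (moveOp a a' T * moveOp b b' T * moveOp c c' T) (std M) = ∑ x, ∑ y, ∑ z,
      (moveCoeff c c' T M z * moveCoeff b b' T (M + shift c c' z) y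
        * moveCoeff a a' T (M + shift c c' z + shift b b' y) x) •
        std (M + shift c c' z + shift b b' y + shift a a' x) := by
  rw [mul_assoc, Module.End.mul_apply, moveOp_moveOp hb hc, map_sum, Finset.sum_comm]
  refine Finset.sum_congr rfl fun y _ => ?_
  rw [map_sum, Finset.sum_comm]
  refine Finset.sum_congr rfl fun z _ => ?_
  rw [map_smul, moveOp_std ha, Finset.smul_sum]
  refine Finset.sum_congr rfl fun x _ => ?_
  rw [smul_smul]


lemma sum_antisymm {N : Type*} [AddCommGroup N] [Module Qv N] {ι : Type*} [Fintype ι]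
    (G : ι → ι → N) (h : ∀ x y, G x y + G y x = 0) : ∑ x, ∑ y, G x y = 0 := by
  have h1 : ∑ x, ∑ y, G x y + ∑ x, ∑ y, G x y = 0 := by
    nth_rewrite 2 [Finset.sum_comm]
    simp [← Finset.sum_add_distrib, h]
  have h2 : (2 : Qv) • ∑ x, ∑ y, G x y = 0 := by rw [two_smul, h1]
  exact (smul_eq_zero.mp h2).resolve_left two_ne_zero

/-- The coefficient in the quantum Serre relation. -/
def serreCoeff (k l k' l' : Fin n) (T : Fin n → Finset (Fin n))
    (M : Matrix (Fin n) (Fin n) ℤ) (w x y : Fin n) : Qv :=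
  moveCoeff k' l' T M w * moveCoeff k l T (M + shift k' l' w) y
      * moveCoeff k l T (M + shift k' l' w + shift k l y) x
    + moveCoeff k l T M y * moveCoeff k l T (M + shift k l y) x
      * moveCoeff k' l' T (M + shift k l y + shift k l x) w
    - (v + v⁻¹) * (moveCoeff k l T M y * moveCoeff k' l' T (M + shift k l y) w
      * moveCoeff k l T (M + shift k l y + shift k' l' w) x)

lemma moveOp_serre {k l k' l' : Fin n} (hkl : k ≠ l) (hkl' : k' ≠ l')
    (T : Fin n → Finset (Fin n))
    (h : ∀ M w x y, serreCoeff k l k' l' T M w x y + serreCoeff k l k' l' T M w y x = 0) :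
    moveOp k l T * moveOp k l T * moveOp k' l' T + moveOp k' l' T * moveOp k l T * moveOp k l T
      = (v + v⁻¹) • (moveOp k l T * moveOp k' l' T * moveOp k l T) := by
  rw [← sub_eq_zero]
  refine end_ext fun A => ?_
  set M := A.1
  rw [LinearMap.sub_apply, LinearMap.add_apply, LinearMap.smul_apply, LinearMap.zero_apply,
    three_moves hkl hkl hkl', three_moves hkl' hkl hkl, three_moves hkl hkl' hkl]
  have e1 : ∀ f : Fin n → Fin n → Fin n → V n,
      ∑ x, ∑ y, ∑ z, f x y z = ∑ z, ∑ x, ∑ y, f x y z := by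
    intro f
    rw [Finset.sum_comm]
    rw [Finset.sum_congr rfl fun y _ => Finset.sum_comm, Finset.sum_comm]
    exact Finset.sum_congr rfl fun z _ => Finset.sum_comm
  have e2 : ∀ f : Fin n → Fin n → Fin n → V n,
      ∑ x, ∑ z, ∑ y, f x y z = ∑ z, ∑ x, ∑ y, f x y z := by
    intro f
    rw [Finset.sum_comm]
  rw [e1, e2 (fun x y z => (moveCoeff k l T M y * moveCoeff k' l' T (M + shift k l y) z
        * moveCoeff k l T (M + shift k l y + shift k' l' z) x) •
        std (M + shift k l y + shift k' l' z + shift k l x)), Finset.smul_sum,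
    ← Finset.sum_add_distrib, ← Finset.sum_sub_distrib]
  refine Finset.sum_eq_zero fun w _ => ?_
  have e3 : ∀ a b : Matrix (Fin n) (Fin n) ℤ, ∀ c, a + b + c = a + c + b := fun a b c =>
    add_right_comm a b c
  have := sum_antisymm (fun x y => serreCoeff k l k' l' T M w x y •
      std (M + shift k' l' w + shift k l y + shift k l x)) (by
    intro x y
    rw [e3 _ (shift k l x) (shift k l y), ← add_smul, h, zero_smul])
  rw [← this, Finset.smul_sum, ← Finset.sum_add_distrib, ← Finset.sum_sub_distrib]
  refine Finset.sum_congr rfl fun x _ => ?_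
  rw [Finset.smul_sum, ← Finset.sum_add_distrib, ← Finset.sum_sub_distrib]
  refine Finset.sum_congr rfl fun y _ => ?_
  have m1 : M + shift k l y + shift k l x + shift k' l' w
      = M + shift k' l' w + shift k l y + shift k l x := by abel
  have m2 : M + shift k l y + shift k' l' w + shift k l x
      = M + shift k' l' w + shift k l y + shift k l x := by abel
  rw [m1, m2, serreCoeff, smul_smul (v + v⁻¹), ← add_smul, ← sub_smul]

lemma serre_scalar₁ {k l m : Fin n} (hkl : k ≠ l) (hlm : l ≠ m) (hkm : k ≠ m)
    {T : Fin n → Finset (Fin n)} (hT : T = Finset.Ioi ∨ T = Finset.Iio)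
    (M : Matrix (Fin n) (Fin n) ℤ) (w x y : Fin n) :
    serreCoeff k l l m T M w x y + serreCoeff k l l m T M w y x = 0 := by
  have h0 := v_ne_zero
  have h4 : v ^ 2 - 1 ≠ 0 := sub_ne_zero.mpr v_sq_ne_one
  have h5 : v - v⁻¹ = (v ^ 2 - 1) / v := by field_simp
  wlog hxy : x ≤ y generalizing x y
  · rw [add_comm]
    exact this y x (le_of_not_ge hxy)
  have z1 := zpow_ne_zero (M k x) h0
  have z2 := zpow_ne_zero (M k y) h0
  have z3 := zpow_ne_zero (M l w) h0
  have z4 := zpow_ne_zero (M l x) h0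
  have z5 := zpow_ne_zero (M l y) h0
  rcases hT with rfl | rfl <;>
  simp only [serreCoeff, moveCoeff_eq, tail_add_shift, Matrix.add_apply, shift_apply, hkl, hlm,
    hkm, hkl.symm, hlm.symm, hkm.symm, Finset.mem_Ioi, Finset.mem_Iio, if_false, if_true] <;>
  rcases hxy.eq_or_lt with h1 | h1 <;>
  rcases lt_trichotomy x w with h2 | h2 | h2 <;>
  rcases lt_trichotomy y w with h3 | h3 | h3 <;>
  first
  | (exfalso; order)
  | skip
  all_goals
    try subst h1
    try subst h2
    try subst h3
  all_goals
    simp only [*, lt_irrefl, not_lt_of_gt, ne_of_gt, ne_of_lt, if_true, if_false, add_zero,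
      sub_zero, zero_sub]
  all_goals
    simp only [qInt, neg_add, neg_neg, zpow_add₀ h0, zpow_neg, zpow_one, h5]
  all_goals
    field_simp
    ring
lemma serre_scalar₂ {k l m : Fin n} (hkl : k ≠ l) (hlm : l ≠ m) (hkm : k ≠ m)
    {T : Fin n → Finset (Fin n)} (hT : T = Finset.Ioi ∨ T = Finset.Iio)
    (M : Matrix (Fin n) (Fin n) ℤ) (w x y : Fin n) :
    serreCoeff l m k l T M w x y + serreCoeff l m k l T M w y x = 0 := by
  have h0 := v_ne_zero
  have h4 : v ^ 2 - 1 ≠ 0 := sub_ne_zero.mpr v_sq_ne_one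
  have h5 : v - v⁻¹ = (v ^ 2 - 1) / v := by field_simp
  wlog hxy : x ≤ y generalizing x y
  · rw [add_comm]
    exact this y x (le_of_not_ge hxy)
  have z1 := zpow_ne_zero (M k w) h0
  have z2 := zpow_ne_zero (M l w) h0
  have z4 := zpow_ne_zero (M l x) h0
  have z5 := zpow_ne_zero (M l y) h0
  rcases hT with rfl | rfl <;>
  simp only [serreCoeff, moveCoeff_eq, tail_add_shift, Matrix.add_apply, shift_apply, hkl, hlm,
    hkm, hkl.symm, hlm.symm, hkm.symm, Finset.mem_Ioi, Finset.mem_Iio, if_false, if_true] <;>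
  rcases hxy.eq_or_lt with h1 | h1 <;>
  rcases lt_trichotomy x w with h2 | h2 | h2 <;>
  rcases lt_trichotomy y w with h3 | h3 | h3 <;>
  first
  | (exfalso; order)
  | skip
  all_goals
    try subst h1
    try subst h2
    try subst h3
  all_goals
    simp only [*, lt_irrefl, not_lt_of_gt, ne_of_gt, ne_of_lt, if_true, if_false, add_zero,
      sub_zero, zero_sub]
  all_goals
    simp only [qInt, neg_add, neg_neg, zpow_add₀ h0, zpow_neg, zpow_one, h5]
  all_goals
    field_simp
    ring
end Action

lemma genOp_rel {r : ℕ} ⦃x y : Free r⦄ (h : Rel r x y) :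
    FreeAlgebra.lift Qv (genOp (r := r)) x = FreeAlgebra.lift Qv (genOp (r := r)) y := by
  have hne : ∀ i : Fin r, i.castSucc ≠ i.succ := fun i => Fin.castSucc_lt_succ.ne
  have hE : ∀ (i : Fin r) (wt wt' : Weight r), wt' = wt + root i →
      moveOp i.castSucc i.succ Finset.Ioi * rowProj wt
        = rowProj wt' * moveOp i.castSucc i.succ Finset.Ioi := fun i wt wt' e =>
    moveOp_rowProj (hne i) _ e
  have hF : ∀ (i : Fin r) (wt wt' : Weight r), wt' = wt - root i →
      moveOp i.succ i.castSucc Finset.Iio * rowProj wt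
        = rowProj wt' * moveOp i.succ i.castSucc Finset.Iio := fun i wt wt' e =>
    moveOp_rowProj (hne i).symm _ (by rw [e, root]; abel)
  have two : ∀ (a b P Q : Module.End Qv (V (r + 1))), b * P = Q * b → P * P = P →
      a * Q * (b * P) = a * b * P := by
    intro a b P Q h1 h2
    rw [mul_assoc, ← mul_assoc Q, ← h1, mul_assoc b, h2, mul_assoc]
  have three : ∀ (a b c P Q R : Module.End Qv (V (r + 1))), c * P = Q * c → b * Q = R * b →
      P * P = P → Q * Q = Q → a * R * (b * Q) * (c * P) = a * b * c * P := by
    intro a b c P Q R h1 h2 h3 h4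
    rw [two a b Q R h2 h4, two (a * b) c P Q h1 h3]
  have serreE : ∀ i j : Fin r, Joined i j →
      moveOp i.castSucc i.succ Finset.Ioi * moveOp i.castSucc i.succ Finset.Ioi
          * moveOp j.castSucc j.succ Finset.Ioi
        + moveOp j.castSucc j.succ Finset.Ioi * moveOp i.castSucc i.succ Finset.Ioi
          * moveOp i.castSucc i.succ Finset.Ioi
      = (v + v⁻¹) • (moveOp i.castSucc i.succ Finset.Ioi * moveOp j.castSucc j.succ Finset.Ioi
          * moveOp i.castSucc i.succ Finset.Ioi) := by
    intro i j hij
    refine moveOp_serre (hne i) (hne j) _ fun M w x y => ?_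
    rcases hij with h | h
    · have e : i.succ = j.castSucc := Fin.ext (by simpa using h)
      rw [e]
      exact serre_scalar₁ (e ▸ hne i) (hne j)
        (by intro h'; have := congrArg Fin.val h'; simp at this; omega) (Or.inl rfl) M w x y
    · have e : j.succ = i.castSucc := Fin.ext (by simpa using h)
      rw [e]
      exact serre_scalar₂ (e ▸ hne j) (hne i)
        (by intro h'; have := congrArg Fin.val h'; simp at this; omega) (Or.inl rfl) M w x y
  have serreF : ∀ i j : Fin r, Joined i j →
      moveOp i.succ i.castSucc Finset.Iio * moveOp i.succ i.castSucc Finset.Iio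
          * moveOp j.succ j.castSucc Finset.Iio
        + moveOp j.succ j.castSucc Finset.Iio * moveOp i.succ i.castSucc Finset.Iio
          * moveOp i.succ i.castSucc Finset.Iio
      = (v + v⁻¹) • (moveOp i.succ i.castSucc Finset.Iio * moveOp j.succ j.castSucc Finset.Iio
          * moveOp i.succ i.castSucc Finset.Iio) := by
    intro i j hij
    refine moveOp_serre (hne i).symm (hne j).symm _ fun M w x y => ?_
    rcases hij with h | h
    · have e : i.succ = j.castSucc := Fin.ext (by simpa using h)
      rw [e]
      exact serre_scalar₂ (hne j).symm (e ▸ (hne i).symm)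
        (by intro h'; have := congrArg Fin.val h'; simp at this; omega) (Or.inr rfl) M w x y
    · have e : j.succ = i.castSucc := Fin.ext (by simpa using h)
      rw [e]
      exact serre_scalar₁ (hne i).symm (e ▸ (hne j).symm)
        (by intro h'; have := congrArg Fin.val h'; simp at this; omega) (Or.inr rfl) M w x y
  have far : ∀ i j : Fin r, i ≠ j → ¬ Joined i j → i.castSucc ≠ j.castSucc ∧
      i.castSucc ≠ j.succ ∧ i.succ ≠ j.castSucc ∧ i.succ ≠ j.succ := by
    intro i j h h'
    have h1 : (i : ℕ) ≠ j := fun e => h (Fin.ext e)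
    simp only [Joined, not_or] at h'
    refine ⟨?_, ?_, ?_, ?_⟩ <;> intro e <;> have := congrArg Fin.val e <;> simp at this <;> omega
  cases h with
  | one_one wt => simp [fone, genOp, rowProj_mul_self]
  | one_ne wt wt' h => simp [fone, genOp, rowProj_mul_ne h]
  | one_E i wt =>
    simp only [fone, fE, map_mul, FreeAlgebra.lift_ι_apply, genOp]
    rw [hE i wt _ rfl, ← mul_assoc, rowProj_mul_self]
  | E_one i wt =>
    simp only [fone, fE, map_mul, FreeAlgebra.lift_ι_apply, genOp]
    rw [mul_assoc, rowProj_mul_self]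
  | one_F i wt =>
    simp only [fone, fF, map_mul, FreeAlgebra.lift_ι_apply, genOp]
    rw [hF i wt _ rfl, ← mul_assoc, rowProj_mul_self]
  | F_one i wt =>
    simp only [fone, fF, map_mul, FreeAlgebra.lift_ι_apply, genOp]
    rw [mul_assoc, rowProj_mul_self]
  | EF_same i wt =>
    simp only [fone, fE, fF, map_mul, map_add, map_smul, FreeAlgebra.lift_ι_apply, genOp]
    rw [two _ _ _ _ (hF i wt _ rfl) (rowProj_mul_self _),
      two _ _ _ _ (hE i wt _ rfl) (rowProj_mul_self _)]
    refine end_ext fun A => ?_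
    rw [Module.End.mul_apply (_ * _), LinearMap.add_apply, Module.End.mul_apply (_ * _),
      LinearMap.smul_apply, rowProj_std]
    split_ifs with hA
    · rw [moveOp_EF (hne i), hA]
    · simp
  | EF_ne i j h wt =>
    simp only [fE, fF, map_mul, FreeAlgebra.lift_ι_apply, genOp]
    rw [two _ _ _ _ (hF j wt _ rfl) (rowProj_mul_self _),
      two _ _ _ _ (hE i wt _ rfl) (rowProj_mul_self _),
      moveOp_comm_opposite (hne i) (hne j)
        (fun e => h (Fin.castSucc_injective _ e)) (fun e => h (Fin.succ_injective _ e))]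
  | E_comm i j h h' wt =>
    simp only [fE, map_mul, FreeAlgebra.lift_ι_apply, genOp]
    obtain ⟨h1, h2, h3, h4⟩ := far i j h h'
    rw [two _ _ _ _ (hE j wt _ rfl) (rowProj_mul_self _),
      two _ _ _ _ (hE i wt _ rfl) (rowProj_mul_self _),
      moveOp_comm_of_disjoint (hne i) (hne j) h1 h2 h3 h4]
  | F_comm i j h h' wt =>
    simp only [fF, map_mul, FreeAlgebra.lift_ι_apply, genOp]
    obtain ⟨h1, h2, h3, h4⟩ := far i j h h'
    rw [two _ _ _ _ (hF j wt _ rfl) (rowProj_mul_self _),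
      two _ _ _ _ (hF i wt _ rfl) (rowProj_mul_self _),
      moveOp_comm_of_disjoint (hne i).symm (hne j).symm h4 h3 h2 h1]
  | E_serre i j h wt =>
    simp only [fE, map_mul, map_add, map_smul, FreeAlgebra.lift_ι_apply, genOp]
    rw [three _ _ _ _ _ _ (hE j wt _ rfl) (hE i _ _ rfl) (rowProj_mul_self _) (rowProj_mul_self _),
      three _ _ _ _ _ _ (hE i wt _ rfl) (hE i _ _ rfl) (rowProj_mul_self _) (rowProj_mul_self _),
      three _ _ _ _ _ _ (hE i wt _ rfl) (hE j _ _ rfl) (rowProj_mul_self _) (rowProj_mul_self _),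
      ← add_mul, serreE i j h, smul_mul_assoc]
  | F_serre i j h wt =>
    simp only [fF, map_mul, map_add, map_smul, FreeAlgebra.lift_ι_apply, genOp]
    rw [three _ _ _ _ _ _ (hF j wt _ rfl) (hF i _ _ rfl) (rowProj_mul_self _) (rowProj_mul_self _),
      three _ _ _ _ _ _ (hF i wt _ rfl) (hF i _ _ rfl) (rowProj_mul_self _) (rowProj_mul_self _),
      three _ _ _ _ _ _ (hF i wt _ rfl) (hF j _ _ rfl) (rowProj_mul_self _) (rowProj_mul_self _),
      ← add_mul, serreF i j h, smul_mul_assoc]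

/-- The left action of `U r` on the span of the symbols `[A]`. -/
def act (r : ℕ) : U r →ₐ[Qv] Module.End Qv (V (r + 1)) :=
  RingQuot.liftAlgHom Qv ⟨FreeAlgebra.lift Qv genOp, genOp_rel⟩

lemma act_gen (r : ℕ) (g : Gen r) :
    act r (RingQuot.mkAlgHom Qv (Rel r) (FreeAlgebra.ι Qv g)) = genOp g := by
  rw [act, RingQuot.liftAlgHom_mkAlgHom_apply, FreeAlgebra.lift_ι_apply]

/-- The coordinates of an element `u` of `U̇ 1_λ` in the standard basis: `1_λ` is `[diag(λ)]`, so
`u = u * [diag(λ)]` is computed by the action on the symbols `[A]`. -/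
def coords {r : ℕ} (wt : Weight r) (u : U r) : V (r + 1) := act r u (std (Matrix.diagonal wt))

/-- The partial order on matrices: equal row and column sums, and the corner sums of `B` are
bounded by those of `A`. -/
def Below {n : ℕ} (B A : Matrix (Fin n) (Fin n) ℤ) : Prop :=
  ro B = ro A ∧ co B = co A ∧
  (∀ i j, i < j → ∑ s ∈ Finset.Iic i, ∑ t ∈ Finset.Ici j, B s t
    ≤ ∑ s ∈ Finset.Iic i, ∑ t ∈ Finset.Ici j, A s t) ∧
  (∀ i j, j < i → ∑ s ∈ Finset.Ici i, ∑ t ∈ Finset.Iic j, B s t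
    ≤ ∑ s ∈ Finset.Ici i, ∑ t ∈ Finset.Iic j, A s t)

/-- `C` is the BLM (stably canonical) basis element `{A}`: it lies in `U̇ 1_{co(A)}`, is
bar-invariant, and `C = [A] + ∑_{B < A} c_B [B]` with `c_B ∈ v⁻¹ ℤ[v⁻¹]`. -/
def IsBLM {r : ℕ} (A : Theta (r + 1)) (C : U r) : Prop :=
  C * one (co A.1) = C ∧ bar r C = C ∧ coords (co A.1) C A = 1 ∧
  ∀ B : Theta (r + 1), B ≠ A →
    coords (co A.1) C B ∈ vInvZ ∧ (coords (co A.1) C B ≠ 0 → Below B.1 A.1)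

/-! ## Simple highest weight modules and their canonical bases -/

/-- Dominant integral weights. -/
def Dominant {r : ℕ} (wt : Weight r) : Prop := ∀ i : Fin r, wt i.succ ≤ wt i.castSucc

/-- The left ideal whose quotient is the Verma module of highest weight `wt`. -/
def vermaIdeal {r : ℕ} (wt : Weight r) : Submodule (U r) (U r) :=
  Submodule.span (U r) ({1 - one wt} ∪ Set.range fun i : Fin r => E i wt)

/-- The sum of all proper left ideals that contain the Verma ideal; modulo the Verma ideal it is
the largest proper submodule of the Verma module. -/
def simpleIdeal {r : ℕ} (wt : Weight r) : Submodule (U r) (U r) :=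
  sSup {J | vermaIdeal wt ≤ J ∧ J ≠ ⊤}

/-- The simple module `L(λ)` of highest weight `λ`. -/
abbrev L {r : ℕ} (wt : Weight r) : Type := U r ⧸ simpleIdeal wt

/-- The highest weight vector `u_λ^+`. -/
def hwVec {r : ℕ} (wt : Weight r) : L wt := Submodule.Quotient.mk 1

/-- `y` is the image of the weight vector `x` under the Kashiwara operator `F̃_i`:
`x = ∑_m F_i^{(m)} x_m` and `y = ∑_m F_i^{(m+1)} x_m`, where the `x_m` are weight vectors killed
by `E_i`. -/
def IsTildeF {r : ℕ} {wt : Weight r} (i : Fin r) (x y : L wt) : Prop :=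
  ∃ (μ : Weight r) (N : ℕ) (w : ℕ → L wt),
    (∀ m : ℕ, one (μ + (m : ℤ) • root i) • w m = w m ∧ E i (μ + (m : ℤ) • root i) • w m = 0) ∧
    x = ∑ m ∈ Finset.range N, divF i m (μ + (m : ℤ) • root i) • w m ∧
    y = ∑ m ∈ Finset.range N, divF i (m + 1) (μ + (m : ℤ) • root i) • w m

/-- The vectors `F̃_{i_1} ⋯ F̃_{i_k} u_λ^+`. -/
inductive IsString {r : ℕ} (wt : Weight r) : L wt → Prop
  | hw : IsString wt (hwVec wt)
  | step (i : Fin r) (x y : L wt) (hx : IsString wt x) (hxy : IsTildeF i x y) : IsString wt y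

/-- The crystal lattice: combinations of the `F̃_{i_1} ⋯ F̃_{i_k} u_λ^+` with coefficients in the
rational functions regular at `v = ∞`. -/
def lattice {r : ℕ} (wt : Weight r) : AddSubgroup (L wt) :=
  AddSubgroup.closure {x | ∃ (c : Qv) (s : L wt), c.intDegree ≤ 0 ∧ IsString wt s ∧ x = c • s}

/-- The `ℤ[v, v⁻¹]`-form of `U r`, generated by the idempotents and the divided powers. -/
def integralForm (r : ℕ) : Subring (U r) :=
  Subring.closure ({x | ∃ wt : Weight r, x = one wt}
    ∪ {x | ∃ (i : Fin r) (a : ℕ) (wt : Weight r), x = divE i a wt ∨ x = divF i a wt}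
    ∪ {algebraMap Qv (U r) v, algebraMap Qv (U r) v⁻¹})

/-- The canonical basis (lower global crystal basis) of `L(λ)`: the vectors of the integral form
that are invariant under the bar involution `x u_λ^+ ↦ \bar x u_λ^+` and are congruent modulo
`v⁻¹` times the crystal lattice to a vector `F̃_{i_1} ⋯ F̃_{i_k} u_λ^+` not in `v⁻¹` times the
crystal lattice. -/
def canonicalBasis {r : ℕ} (wt : Weight r) : Set (L wt) :=
  {b | (∃ x ∈ integralForm r, b = x • hwVec wt) ∧
    (∃ x : U r, b = x • hwVec wt ∧ b = bar r x • hwVec wt) ∧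
    ∃ s : L wt, IsString wt s ∧ (∀ y ∈ lattice wt, s ≠ v⁻¹ • y) ∧
      ∃ y ∈ lattice wt, b - s = v⁻¹ • y}

/-! ## The matrices of the rank one example -/

/-- The matrix with rows `(p, 1)` and `(a, a₂₂ + p)`. -/
def exMatrix (a : ℕ) (a₂₂ p : ℤ) : Theta 2 :=
  ⟨!![p, 1; (a : ℤ), a₂₂ + p], by
    intro i j h
    fin_cases i <;> fin_cases j <;> simp at h ⊢⟩

end

end QuantumGL

open QuantumGL

namespace QuantumGL

noncomputable section

variable {r : ℕ}

/-! ## Relations in `U r` -/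

/-! Everything comes from comparing two computations with `E F^{(b+1)} 1_λ`. On the highest weight
vector `u` it gives `[λ₁ - λ₂ - b] F^{(b)} u`, which depends only on the difference `λ₁ - λ₂`. Its
standard basis coordinates depend on `λ₁` and `λ₂` separately, because the second term carries the
coefficient `v^{-λ₂} [λ₁ - b]`. Here `[m]` is the bar-invariant quantum integer, as in all comments
below.

For (1), take `λ = (0, -2, ..., -2)` and `C = E₁ F₁ 1_λ`. As `λ₁ = 0`, the second term vanishes and
`C` is a single symbol `[A]`; being bar-invariant, it is `{A}` (`isBLM_E_mul_F`). Yet `C u = [2] u`.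
This is not canonical: the coefficient of `u` is regular at `v = ∞` on the crystal lattice and is
`0` or `1` on each vector `F̃_{i_1} ⋯ F̃_{i_k} u`, whereas `[2] = v + v⁻¹` has a pole
(`qInt_two_smul_hwVec_notMem`).

Such a coefficient functional must exist on `L(λ)`, which includes that the Verma ideal is proper.
This is read off from an explicit representation on Laurent monomials (`fock`), in which a weight
whose entries after the first all equal `d` is killed by every `E_i`. The functional descends to
`L(λ)` by `simpleIdeal_le_expectIdeal`. For `n = 2` every weight has this shape, with `d = λ₂`.

For (2), write `a₂₁ = b + 1` and `k = λ₂`. The offending coefficient is now `v^{-k} [p+1]`.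
Subtracting the bar-invariant multiple `[p+1] (v^k + v^{-k})` of `F^{(b)} 1_λ` turns it into `-v^k
[p+1]`, which lies in `v⁻¹ ℤ[v⁻¹]` for the given signs (`isBLM_exElement`). On `u` the scalars
combine to `[-a₂₂ - 2p - 2]`. That the element is the only one with these properties
(`IsBLM.unique`) follows by expanding in the bar-invariant monomials `E^i F^j 1_λ`, which are
triangular with respect to the standard basis. -/

lemma one_mul_one (wt : Weight r) : one wt * one wt = one wt := by
  simpa [one] using RingQuot.mkAlgHom_rel Qv (Rel.one_one wt)

lemma one_mul_one_ne {wt wt' : Weight r} (h : wt ≠ wt') : one wt * one wt' = 0 := by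
  simpa [one] using RingQuot.mkAlgHom_rel Qv (Rel.one_ne wt wt' h)

lemma one_mul_E (i : Fin r) (wt : Weight r) : one (wt + root i) * E i wt = E i wt := by
  simpa [one, E] using RingQuot.mkAlgHom_rel Qv (Rel.one_E i wt)

lemma E_mul_one (i : Fin r) (wt : Weight r) : E i wt * one wt = E i wt := by
  simpa [one, E] using RingQuot.mkAlgHom_rel Qv (Rel.E_one i wt)

lemma one_mul_F (i : Fin r) (wt : Weight r) : one (wt - root i) * F i wt = F i wt := by
  simpa [one, F] using RingQuot.mkAlgHom_rel Qv (Rel.one_F i wt)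

lemma F_mul_one (i : Fin r) (wt : Weight r) : F i wt * one wt = F i wt := by
  simpa [one, F] using RingQuot.mkAlgHom_rel Qv (Rel.F_one i wt)

lemma E_mul_F_same (i : Fin r) (wt : Weight r) : E i (wt - root i) * F i wt
    = F i (wt + root i) * E i wt + qInt (wt i.castSucc - wt i.succ) • one wt := by
  have h := RingQuot.mkAlgHom_rel Qv (Rel.EF_same i wt)
  rwa [map_mul, map_add, map_mul, map_smul] at h

lemma E_mul_F_ne {i j : Fin r} (h : i ≠ j) (wt : Weight r) :
    E i (wt - root j) * F j wt = F j (wt + root i) * E i wt := by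
  have h := RingQuot.mkAlgHom_rel Qv (Rel.EF_ne i j h wt)
  rwa [map_mul, map_mul] at h

lemma E_mul_of_one_mul (i : Fin r) {wt μ : Weight r} {x : U r} (hx : one μ * x = x)
    (h : wt ≠ μ) : E i wt * x = 0 := by
  rw [← hx, ← E_mul_one, mul_assoc, ← mul_assoc (one wt), one_mul_one_ne h, zero_mul, mul_zero]

lemma F_mul_of_one_mul (i : Fin r) {wt μ : Weight r} {x : U r} (hx : one μ * x = x)
    (h : wt ≠ μ) : F i wt * x = 0 := by
  rw [← hx, ← F_mul_one, mul_assoc, ← mul_assoc (one wt), one_mul_one_ne h, zero_mul, mul_zero]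

lemma one_mul_of_one_mul {wt μ : Weight r} {x : U r} (hx : one μ * x = x)
    (h : wt ≠ μ) : one wt * x = 0 := by
  rw [← hx, ← mul_assoc, one_mul_one_ne h, zero_mul]

/-- A subspace stable under left multiplication by the generators is stable under left
multiplication. -/
lemma mul_mem_of_gen_mul_mem (P : Submodule Qv (U r))
    (hone : ∀ wt, ∀ x ∈ P, one wt * x ∈ P) (hE : ∀ i wt, ∀ x ∈ P, E i wt * x ∈ P)
    (hF : ∀ i wt, ∀ x ∈ P, F i wt * x ∈ P) (u : U r) : ∀ x ∈ P, u * x ∈ P := by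
  obtain ⟨f, rfl⟩ := RingQuot.mkAlgHom_surjective Qv (Rel r) u
  induction f using FreeAlgebra.induction with
  | grade0 c =>
    intro x hx
    rw [AlgHom.commutes, ← Algebra.smul_def]
    exact P.smul_mem c hx
  | grade1 g =>
    intro x hx
    cases g with
    | one wt => exact hone wt x hx
    | E i wt => exact hE i wt x hx
    | F i wt => exact hF i wt x hx
  | mul a b ha hb =>
    intro x hx
    rw [map_mul, mul_assoc]
    exact ha _ (hb _ hx)
  | add a b ha hb =>
    intro x hx
    rw [map_add, add_mul]
    exact P.add_mem (ha _ hx) (hb _ hx)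

lemma bar_one (wt : Weight r) : bar r (one wt) = one wt := bar_gen r (.one wt)
lemma bar_E (i : Fin r) (wt : Weight r) : bar r (E i wt) = E i wt := bar_gen r (.E i wt)
lemma bar_F (i : Fin r) (wt : Weight r) : bar r (F i wt) = F i wt := bar_gen r (.F i wt)

lemma bar_smul (c : Qv) (x : U r) : bar r (c • x) = barQ c • bar r x := by
  obtain ⟨f, rfl⟩ := RingQuot.mkAlgHom_surjective Qv (Rel r) x
  have h : ∀ y, bar r (RingQuot.mkAlgHom Qv (Rel r) y) = barFree r y := by
    intro y
    have := RingQuot.lift_mkRingHom_apply (barFree r) (barFree_rel r) y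
    rwa [← RingQuot.mkAlgHom_coe Qv (Rel r)] at this
  rw [← map_smul, h, h, barFree_smul]

/-! ## A Fock space representation -/

/-- Matrix units on the space with basis the integral weights. -/
def unit (a b : Weight r) : Module.End Qv (Weight r →₀ Qv) :=
  Finsupp.lsingle a ∘ₗ Finsupp.lapply b

lemma unit_mul_unit (a b c : Weight r) : unit a b * unit b c = unit a c := by
  refine LinearMap.ext fun x => ?_
  simp [unit]

lemma unit_mul_unit_ne (a d : Weight r) {b c : Weight r} (h : b ≠ c) :
    unit a b * unit c d = 0 := by
  refine LinearMap.ext fun x => ?_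
  simp [unit, h]

/-- The operators of the generators on the Fock space, shifted by the `d`-th power of the
determinant. -/
def fockGen (d : ℤ) : Gen r → Module.End Qv (Weight r →₀ Qv)
  | .one wt => unit wt wt
  | .E i wt => qInt (wt i.succ - d) • unit (wt + root i) wt
  | .F i wt => qInt (wt i.castSucc - d) • unit (wt - root i) wt

/-- The scalar form of the relation between `E_i` and `F_i`. It serves for the Fock space and again
for the induction on powers of `F_i`. -/
lemma qInt_add_one_mul (a b : ℤ) :
    qInt (b + 1) * qInt a = qInt (a + 1) * qInt b + qInt (a - b) := by
  have h0 := v_ne_zero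
  have h2 : v ^ a ≠ 0 := zpow_ne_zero _ h0
  have h3 : v ^ b ≠ 0 := zpow_ne_zero _ h0
  have h4 : v ^ 2 - 1 ≠ 0 := sub_ne_zero.mpr v_sq_ne_one
  have h5 : v - v⁻¹ = (v ^ 2 - 1) / v := by field_simp
  simp only [qInt, neg_add, neg_sub, zpow_add₀ h0, zpow_sub₀ h0, zpow_neg, zpow_one, h5]
  field_simp
  ring

lemma qInt_neg (a : ℤ) : qInt (-a) = -qInt a := by
  rw [qInt, qInt, neg_neg, ← neg_div, neg_sub]

/-- The product-to-sum formula. With `b = 1` it yields the Serre relations on the Fock space; with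
`b = λ₂` it evaluates the correction term in (2). -/
lemma qInt_mul_v_zpow_add (a b : ℤ) :
    qInt a * (v ^ b + v ^ (-b)) = qInt (a + b) + qInt (a - b) := by
  have h0 := v_ne_zero
  have h1 := v_sub_inv_ne_zero
  have h2 : v ^ a ≠ 0 := zpow_ne_zero _ h0
  have h3 : v ^ b ≠ 0 := zpow_ne_zero _ h0
  simp only [qInt, neg_add, neg_sub, zpow_add₀ h0, zpow_sub₀ h0, zpow_neg]
  field_simp
  ring

lemma qInt_one : qInt 1 = 1 := by
  rw [qInt, zpow_one, zpow_neg, zpow_one, div_self v_sub_inv_ne_zero]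

lemma qInt_two : qInt 2 = v + v⁻¹ := by
  have h := qInt_mul_v_zpow_add 1 1
  simpa [qInt_one, qInt_zero] using h.symm

lemma qInt_add_two (a : ℤ) : qInt (a + 2) + qInt a = (v + v⁻¹) * qInt (a + 1) := by
  have h := qInt_mul_v_zpow_add (a + 1) 1
  rw [add_assoc, add_sub_cancel_right] at h
  simpa [mul_comm] using h.symm

lemma root_castSucc (i j : Fin r) : root j i.castSucc
    = (if i = j then 1 else 0) - (if (j : ℕ) + 1 = i then 1 else 0) := by
  simp [root, Pi.single_apply, Fin.ext_iff, eq_comm]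

lemma root_succ (i j : Fin r) : root j i.succ
    = (if (i : ℕ) + 1 = j then 1 else 0) - (if i = j then 1 else 0) := by
  simp [root, Pi.single_apply, Fin.ext_iff, eq_comm]

/-- Every generator is a multiple of a matrix unit, so each relation reduces to an identity between
scalars. The `E_i F_i` relation is `qInt_add_one_mul` for the two entries shifted by `d`. In a Serre
relation the three words differ only by shifts in the entry that the adjacent nodes share, and what
remains is `[x+2] + [x] = [2] [x+1]`. -/
lemma fockGen_rel (d : ℤ) ⦃x y : Free r⦄ (h : Rel r x y) :
    FreeAlgebra.lift Qv (fockGen d) x = FreeAlgebra.lift Qv (fockGen d) y := by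
  have key : ∀ i j : Fin r, Joined i j → (i : ℕ) ≠ j := by
    rintro i j (h | h) <;> omega
  cases h with
  | one_one wt => simp [fone, fockGen, unit_mul_unit]
  | one_ne wt wt' h => simp [fone, fockGen, unit_mul_unit_ne _ _ h]
  | one_E i wt => simp [fone, fE, fockGen, unit_mul_unit]
  | E_one i wt => simp [fone, fE, fockGen, unit_mul_unit]
  | one_F i wt => simp [fone, fF, fockGen, unit_mul_unit]
  | F_one i wt => simp [fone, fF, fockGen, unit_mul_unit]
  | EF_same i wt =>
    have h1 := unit_mul_unit wt (wt - root i) wt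
    have h2 := unit_mul_unit wt (wt + root i) wt
    simp only [fone, fE, fF, map_mul, map_add, map_smul, FreeAlgebra.lift_ι_apply, fockGen,
      smul_mul_smul_comm, sub_add_cancel, add_sub_cancel_right, h1, h2, ← add_smul]
    congr 1
    simp only [Pi.add_apply, Pi.sub_apply, root_succ, root_castSucc]
    have := qInt_add_one_mul (wt i.castSucc - d) (wt i.succ - d)
    simp only [sub_sub_sub_cancel_right] at this
    simp only [if_true, Nat.succ_ne_self, if_false, zero_sub, sub_neg_eq_add, sub_zero]
    rw [add_sub_right_comm, this, add_sub_right_comm]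
  | EF_ne i j h wt =>
    simp only [fE, fF, map_mul, FreeAlgebra.lift_ι_apply, fockGen,
      smul_mul_smul_comm, sub_add_eq_add_sub, unit_mul_unit]
    congr 1
    simp only [Pi.add_apply, Pi.sub_apply, root_succ, root_castSucc, h, h.symm, if_false]
    -- If `j = i + 1`, both operators read the same entry and each lowers it by one, so either order
    -- gives `[x] [x-1]`. Otherwise neither operator changes the entry read by the other.
    by_cases h' : (i : ℕ) + 1 = j
    · simp [h', mul_comm]
      have e : j.castSucc = i.succ := Fin.ext (by simp [h'])
      rw [e, mul_comm, sub_right_comm, ← sub_eq_add_neg, sub_right_comm, mul_comm]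
    · simp [h', mul_comm]
  | E_comm i j h h' wt =>
    simp only [Joined, not_or] at h'
    simp only [fE, map_mul, FreeAlgebra.lift_ι_apply, fockGen, smul_mul_smul_comm, unit_mul_unit]
    rw [add_right_comm]
    congr 1
    simp [root_succ, h, h.symm, h', mul_comm]
  | F_comm i j h h' wt =>
    simp only [Joined, not_or] at h'
    simp only [fF, map_mul, FreeAlgebra.lift_ι_apply, fockGen, smul_mul_smul_comm, unit_mul_unit]
    rw [sub_right_comm]
    congr 1
    simp [root_castSucc, h, h.symm, h', mul_comm]
  | E_serre i j h wt =>
    simp only [fE, map_mul, map_add, map_smul, FreeAlgebra.lift_ι_apply, fockGen,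
      smul_mul_smul_comm, unit_mul_unit]
    have e1 : wt + root i + root i + root j = wt + root j + root i + root i := by abel
    have e2 : wt + root i + root j + root i = wt + root j + root i + root i := by abel
    rw [e1, e2, ← add_smul, smul_smul]
    congr 1
    have hij : i ≠ j := fun e => key i j h (by rw [e])
    simp only [Pi.add_apply, root_succ, hij, hij.symm, if_false, if_true, Nat.succ_ne_self]
    rcases h with h | h
    · have h' : (j : ℕ) + 1 ≠ i := by omega
      simp only [h, h', if_true, if_false]

      have e := qInt_add_two (wt i.succ - d - 1)
      obtain ⟨X, hX⟩ : ∃ X, wt i.succ = X + d := ⟨_, (sub_add_cancel _ _).symm⟩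
      obtain ⟨Y, hY⟩ : ∃ Y, wt j.succ = Y + d := ⟨_, (sub_add_cancel _ _).symm⟩
      rw [hX] at e ⊢
      rw [hY]
      ring_nf at e ⊢
      linear_combination (qInt X * qInt Y) * e
    · have h' : (i : ℕ) + 1 ≠ j := by omega
      simp only [h, h', if_true, if_false]
      have e := qInt_add_two (wt j.succ - d)
      obtain ⟨X, hX⟩ : ∃ X, wt i.succ = X + d := ⟨_, (sub_add_cancel _ _).symm⟩
      obtain ⟨Y, hY⟩ : ∃ Y, wt j.succ = Y + d := ⟨_, (sub_add_cancel _ _).symm⟩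
      rw [hY] at e ⊢
      rw [hX]
      ring_nf at e ⊢
      linear_combination (qInt X * qInt (-1 + X)) * e
  | F_serre i j h wt =>
    simp only [fF, map_mul, map_add, map_smul, FreeAlgebra.lift_ι_apply, fockGen,
      smul_mul_smul_comm, unit_mul_unit]
    have e1 : wt - root i - root i - root j = wt - root j - root i - root i := by abel
    have e2 : wt - root i - root j - root i = wt - root j - root i - root i := by abel
    rw [e1, e2, ← add_smul, smul_smul]
    congr 1
    have hij : i ≠ j := fun e => key i j h (by rw [e])
    simp only [Pi.sub_apply, root_castSucc, hij, hij.symm, if_false, if_true, Nat.succ_ne_self]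
    rcases h with h | h
    · have h' : (j : ℕ) + 1 ≠ i := by omega
      simp only [h, h', if_true, if_false]
      have e := qInt_add_two (wt j.castSucc - d)
      obtain ⟨X, hX⟩ : ∃ X, wt i.castSucc = X + d := ⟨_, (sub_add_cancel _ _).symm⟩
      obtain ⟨Y, hY⟩ : ∃ Y, wt j.castSucc = Y + d := ⟨_, (sub_add_cancel _ _).symm⟩
      rw [hY] at e ⊢
      rw [hX]
      ring_nf at e ⊢
      linear_combination (qInt X * qInt (-1 + X)) * e
    · have h' : (i : ℕ) + 1 ≠ j := by omega
      simp only [h, h', if_true, if_false]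
      have e := qInt_add_two (wt i.castSucc - d - 1)
      obtain ⟨X, hX⟩ : ∃ X, wt i.castSucc = X + d := ⟨_, (sub_add_cancel _ _).symm⟩
      obtain ⟨Y, hY⟩ : ∃ Y, wt j.castSucc = Y + d := ⟨_, (sub_add_cancel _ _).symm⟩
      rw [hX] at e ⊢
      rw [hY]
      ring_nf at e ⊢
      linear_combination (qInt X * qInt Y) * e

/-- The Fock space representation. -/
def fock (r : ℕ) (d : ℤ) : U r →ₐ[Qv] Module.End Qv (Weight r →₀ Qv) :=
  RingQuot.liftAlgHom Qv ⟨FreeAlgebra.lift Qv (fockGen d), fockGen_rel d⟩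

lemma fock_gen (d : ℤ) (g : Gen r) :
    fock r d (RingQuot.mkAlgHom Qv (Rel r) (FreeAlgebra.ι Qv g)) = fockGen d g := by
  rw [fock, RingQuot.liftAlgHom_mkAlgHom_apply, FreeAlgebra.lift_ι_apply]

lemma fock_one (d : ℤ) (wt : Weight r) : fock r d (one wt) = unit wt wt := fock_gen d (.one wt)

lemma fock_E (d : ℤ) (i : Fin r) (wt : Weight r) :
    fock r d (E i wt) = qInt (wt i.succ - d) • unit (wt + root i) wt := fock_gen d (.E i wt)

/-! ## The vacuum expectation on the simple module -/

lemma one_sub_one_mem_vermaIdeal (wt : Weight r) : 1 - one wt ∈ vermaIdeal wt :=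
  Submodule.subset_span (Or.inl rfl)

lemma E_mem_vermaIdeal (i : Fin r) (wt : Weight r) : E i wt ∈ vermaIdeal wt :=
  Submodule.subset_span (Or.inr ⟨i, rfl⟩)

/-! ### Spanning the Verma module by words in the `F_i`, and the vacuum functional -/

/-- Products of `k` of the `F_i` applied to `1_wt`, of weight `μ`. -/
inductive FWord (wt : Weight r) : ℕ → Weight r → U r → Prop
  | one : FWord wt 0 wt (one wt)
  | F (i : Fin r) {k : ℕ} {μ : Weight r} {x : U r} (h : FWord wt k μ x) :
      FWord wt (k + 1) (μ - root i) (F i μ * x)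

/-- A linear functional on weights with value `1` on all simple roots. -/
def height (μ : Weight r) : ℤ := -∑ j : Fin (r + 1), ((j : ℕ) : ℤ) * μ j

lemma height_sub_root (μ : Weight r) (i : Fin r) : height (μ - root i) = height μ - 1 := by
  simp only [height, root, Pi.sub_apply, mul_sub, Finset.sum_sub_distrib, Pi.single_apply,
    mul_ite, mul_one, mul_zero, Finset.sum_ite_eq', Finset.mem_univ, if_true]
  simp
  ring

lemma FWord.height {wt μ : Weight r} {k : ℕ} {x : U r} (h : FWord wt k μ x) :
    height μ = QuantumGL.height wt - k := by
  induction h with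
  | one => simp
  | F i h ih => rw [height_sub_root, ih]; push_cast; ring

lemma FWord.one_mul {wt μ : Weight r} {k : ℕ} {x : U r} (h : FWord wt k μ x) :
    QuantumGL.one μ * x = x := by
  induction h with
  | one => exact one_mul_one wt
  | F i h ih => rw [← mul_assoc, one_mul_F]

/-- The span of the Verma ideal and the words in the `F_i` applied to `1_wt`. -/
def wordSpan (wt : Weight r) : Submodule Qv (U r) :=
  (vermaIdeal wt).restrictScalars Qv ⊔ Submodule.span Qv {x | ∃ k μ, FWord wt k μ x}

lemma FWord.mem_wordSpan {wt μ : Weight r} {k : ℕ} {x : U r} (h : FWord wt k μ x) :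
    x ∈ wordSpan wt :=
  (le_sup_right : _ ≤ wordSpan wt) (Submodule.subset_span ⟨k, μ, h⟩)

lemma mem_wordSpan_of_mem {wt : Weight r} {x : U r} (h : x ∈ vermaIdeal wt) : x ∈ wordSpan wt :=
  (le_sup_left : _ ≤ wordSpan wt) h

lemma mul_mem_wordSpan_of_forall (wt : Weight r) (a : U r)
    (h : ∀ k μ x, FWord wt k μ x → a * x ∈ wordSpan wt) :
    ∀ x ∈ wordSpan wt, a * x ∈ wordSpan wt := by
  have h1 : wordSpan wt ≤ (wordSpan wt).comap (LinearMap.mulLeft Qv a) := by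
    refine sup_le (fun x hx => mem_wordSpan_of_mem ((vermaIdeal wt).smul_mem a hx)) ?_
    rw [Submodule.span_le]
    rintro x ⟨k, μ, hx⟩
    exact h k μ x hx
  exact fun x hx => h1 hx

lemma F_mul_mem_wordSpan (wt : Weight r) (i : Fin r) (ν : Weight r) :
    ∀ x ∈ wordSpan wt, F i ν * x ∈ wordSpan wt := by
  refine mul_mem_wordSpan_of_forall wt _ fun k μ x hx => ?_
  by_cases h : ν = μ
  · subst h
    exact (FWord.F i hx).mem_wordSpan
  · rw [F_mul_of_one_mul i hx.one_mul h]
    exact zero_mem _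

/-- `E_i` is moved to the right through the word until it meets `1_wt`, where it falls into the
Verma ideal. The commutators arising on the way are multiples of shorter words. -/
lemma E_mul_mem_wordSpan (wt : Weight r) (i : Fin r) (ν : Weight r) :
    ∀ x ∈ wordSpan wt, E i ν * x ∈ wordSpan wt := by
  refine mul_mem_wordSpan_of_forall wt _ fun k μ x hx => ?_
  induction hx generalizing ν with
  | one =>
    by_cases h : ν = wt
    · subst h
      rw [E_mul_one]
      exact mem_wordSpan_of_mem (E_mem_vermaIdeal i _)
    · rw [E_mul_of_one_mul i (one_mul_one wt) h]
      exact zero_mem _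
  | @F j k μ x hx ih =>
    by_cases h : ν = μ - root j
    · subst h
      rw [← mul_assoc]
      by_cases hij : i = j
      · subst hij
        rw [E_mul_F_same, add_mul, mul_assoc, smul_mul_assoc, hx.one_mul]
        exact add_mem (F_mul_mem_wordSpan wt i _ _ (ih _)) (Submodule.smul_mem _ _ hx.mem_wordSpan)
      · rw [E_mul_F_ne hij, mul_assoc]
        exact F_mul_mem_wordSpan wt j _ _ (ih _)
    · rw [E_mul_of_one_mul i (FWord.F j hx).one_mul h]
      exact zero_mem _

lemma mem_wordSpan (wt : Weight r) (x : U r) : x ∈ wordSpan wt := by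
  -- The adjoined unit agrees with `1_wt` modulo the Verma ideal, so stability under the generators
  -- is all that remains.
  have h1 : (1 : U r) ∈ wordSpan wt := by
    rw [← sub_add_cancel 1 (one wt)]
    exact add_mem (mem_wordSpan_of_mem (one_sub_one_mem_vermaIdeal wt)) FWord.one.mem_wordSpan
  rw [← mul_one x]
  refine mul_mem_of_gen_mul_mem (wordSpan wt) (fun ν => ?_) (E_mul_mem_wordSpan wt)
    (F_mul_mem_wordSpan wt) x 1 h1
  refine mul_mem_wordSpan_of_forall wt _ fun k μ x hx => ?_
  by_cases h : ν = μ
  · subst h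
    rw [hx.one_mul]
    exact hx.mem_wordSpan
  · rw [one_mul_of_one_mul hx.one_mul h]
    exact zero_mem _

/-- Weights that are highest weights of vectors in the Fock space. -/
def IsVacuum (d : ℤ) (wt : Weight r) : Prop := ∀ i : Fin r, wt i.succ = d

/-- The coefficient of the highest weight vector in `x` applied to it. -/
def expect (d : ℤ) (wt : Weight r) : U r →ₗ[Qv] Qv :=
  Finsupp.lapply wt ∘ₗ LinearMap.applyₗ (Finsupp.single wt 1) ∘ₗ (fock r d).toLinearMap

lemma expect_apply (d : ℤ) (wt : Weight r) (x : U r) :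
    expect d wt x = fock r d x (Finsupp.single wt 1) wt := rfl

/-- On a vacuum weight `E_i` acts by `[λ_{i+1} - d] = [0] = 0`, so the basis vector at `wt` is a
highest weight vector of the Fock space. -/
lemma fock_of_mem_vermaIdeal {d : ℤ} {wt : Weight r} (h : IsVacuum d wt) {x : U r}
    (hx : x ∈ vermaIdeal wt) : fock r d x (Finsupp.single wt 1) = 0 := by
  induction hx using Submodule.span_induction with
  | mem x hx =>
    rcases hx with rfl | ⟨i, rfl⟩
    · simp [fock_one, unit]
    · simp [fock_E, h i, qInt_zero]
  | zero => simp
  | add x y _ _ hx hy => simp [hx, hy]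
  | smul a x _ hx => simp [hx]

lemma expect_of_mem_vermaIdeal {d : ℤ} {wt : Weight r} (h : IsVacuum d wt) {x : U r}
    (hx : x ∈ vermaIdeal wt) : expect d wt x = 0 := by
  rw [expect_apply, fock_of_mem_vermaIdeal h hx, Finsupp.zero_apply]

lemma expect_one (d : ℤ) (wt : Weight r) : expect d wt 1 = 1 := by
  simp [expect_apply]

lemma expect_one_wt (d : ℤ) (wt : Weight r) : expect d wt (one wt) = 1 := by
  simp [expect_apply, fock_one, unit]

lemma expect_one_mul (d : ℤ) {wt : Weight r} (x : U r) :
    expect d wt (one wt * x) = expect d wt x := by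
  simp [expect_apply, fock_one, unit]

lemma expect_of_ne (d : ℤ) {wt μ : Weight r} {x : U r} (hx : one μ * x = x) (h : μ ≠ wt) :
    expect d wt x = 0 := by
  rw [← expect_one_mul, one_mul_of_one_mul hx h.symm, map_zero]

lemma FWord.expect_succ (d : ℤ) {wt μ : Weight r} {k : ℕ} {x : U r}
    (hx : FWord wt (k + 1) μ x) : expect d wt x = 0 := by
  refine expect_of_ne d hx.one_mul fun h => ?_
  have := hx.height
  rw [h] at this
  push_cast at this
  omega

/-- On the whole Fock space `F_i` can map onto the vector of weight `wt`. It cannot do so on the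
submodule generated by that vector: modulo the Verma ideal this is spanned by words in the `F_i`,
and a word of positive length has smaller height. -/
lemma expect_F_mul {d : ℤ} {wt : Weight r} (h : IsVacuum d wt) (i : Fin r) (ν : Weight r)
    (x : U r) : expect d wt (F i ν * x) = 0 := by
  have h1 : wordSpan wt ≤ (LinearMap.ker (expect d wt)).comap (LinearMap.mulLeft Qv (F i ν)) := by
    refine sup_le (fun x hx => expect_of_mem_vermaIdeal h ((vermaIdeal wt).smul_mem _ hx)) ?_
    rw [Submodule.span_le]
    rintro x ⟨k, μ, hx⟩
    change expect d wt (F i ν * x) = 0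
    by_cases e : ν = μ
    · subst e
      exact (FWord.F i hx).expect_succ d
    · rw [F_mul_of_one_mul i hx.one_mul e, map_zero]
  exact h1 (mem_wordSpan wt x)

/-- The weight space of the Verma module at its highest weight is one-dimensional: among the words
in the `F_i`, only the empty one survives left multiplication by `1_wt`. -/
lemma one_mul_sub_expect_mem {d : ℤ} {wt : Weight r} (h : IsVacuum d wt) (x : U r) :
    one wt * x - expect d wt x • 1 ∈ vermaIdeal wt := by
  have h1 : wordSpan wt ≤ ((vermaIdeal wt).restrictScalars Qv).comap
      (LinearMap.mulLeft Qv (one wt) - (expect d wt).smulRight 1) := by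
    refine sup_le (fun x hx => ?_) ?_
    · change one wt * x - expect d wt x • 1 ∈ vermaIdeal wt
      rw [expect_of_mem_vermaIdeal h hx, zero_smul, sub_zero]
      exact (vermaIdeal wt).smul_mem _ hx
    · rw [Submodule.span_le]
      rintro x ⟨k, μ, hx⟩
      change one wt * x - expect d wt x • 1 ∈ vermaIdeal wt
      cases hx with
      | one =>
        rw [one_mul_one, expect_one_wt, one_smul, ← neg_sub]
        exact neg_mem (one_sub_one_mem_vermaIdeal wt)
      | @F i k μ x hx =>
        have hx' := FWord.F i hx
        rw [hx'.expect_succ d, one_mul_of_one_mul hx'.one_mul, zero_smul, sub_zero]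
        · exact zero_mem _
        · intro e
          have := hx'.height
          rw [← e] at this
          push_cast at this
          omega
  exact h1 (mem_wordSpan wt x)

lemma vermaIdeal_ne_top {d : ℤ} {wt : Weight r} (h : IsVacuum d wt) : vermaIdeal wt ≠ ⊤ := by
  intro h1
  have h2 := expect_of_mem_vermaIdeal h (x := 1) (h1 ▸ Submodule.mem_top)
  rw [expect_one] at h2
  exact one_ne_zero h2

/-- Properness is essential: were the Verma ideal everything, the supremum defining `simpleIdeal`
would be over the empty set and equal to `⊥`. -/
lemma vermaIdeal_le_simpleIdeal {d : ℤ} {wt : Weight r} (h : IsVacuum d wt) :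
    vermaIdeal wt ≤ simpleIdeal wt :=
  le_sSup ⟨le_rfl, vermaIdeal_ne_top h⟩

/-- The left ideal on which all matrix coefficients of the vacuum expectation vanish. -/
def expectIdeal (d : ℤ) (wt : Weight r) : Submodule (U r) (U r) where
  carrier := {x | ∀ y, expect d wt (y * x) = 0}
  zero_mem' := by simp
  add_mem' := by
    intro a b ha hb y
    rw [mul_add, map_add, ha, hb, add_zero]
  smul_mem' := by
    intro c x hx y
    rw [smul_eq_mul, ← mul_assoc]
    exact hx _

/-- If some `y x` with `x` in `J` had a nonzero vacuum coefficient, then `1_wt y x` would be a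
nonzero scalar modulo the Verma ideal, and `J` would contain `1`. So each proper left ideal above
the Verma ideal lies in `expectIdeal`, and hence so does their sum. -/
lemma simpleIdeal_le_expectIdeal {d : ℤ} {wt : Weight r} (h : IsVacuum d wt) :
    simpleIdeal wt ≤ expectIdeal d wt := by
  refine sSup_le ?_
  rintro J ⟨hJ, hJ'⟩ x hx y
  by_contra hne
  apply hJ'
  rw [Ideal.eq_top_iff_one]
  have h1 : expect d wt (y * x) • (1 : U r) ∈ J := by
    rw [← sub_sub_cancel (one wt * (y * x)) (expect d wt (y * x) • 1)]
    refine sub_mem ?_ (hJ (one_mul_sub_expect_mem h _))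
    rw [← mul_assoc]
    exact J.smul_mem _ hx
  have h2 := (J.restrictScalars Qv).smul_mem (expect d wt (y * x))⁻¹ h1
  rwa [smul_smul, inv_mul_cancel₀ hne, one_smul] at h2

lemma expect_of_mem_simpleIdeal {d : ℤ} {wt : Weight r} (h : IsVacuum d wt) {x : U r}
    (hx : x ∈ simpleIdeal wt) : expect d wt x = 0 := by
  rw [← one_mul x]
  exact simpleIdeal_le_expectIdeal h hx 1

/-! ### The highest weight coefficient on the crystal lattice, and why `[2] u` is not canonical -/

/-- The coefficient of the highest weight vector of `L wt`. -/
def hwCoeff {d : ℤ} {wt : Weight r} (h : IsVacuum d wt) : L wt →ₗ[Qv] Qv :=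
  ((simpleIdeal wt).restrictScalars Qv).liftQ (expect d wt)
    (fun _ hx => expect_of_mem_simpleIdeal h hx) ∘ₗ
      (Submodule.Quotient.restrictScalarsEquiv Qv (simpleIdeal wt)).symm.toLinearMap

lemma hwCoeff_mk {d : ℤ} {wt : Weight r} (h : IsVacuum d wt) (x : U r) :
    hwCoeff h (Submodule.Quotient.mk x) = expect d wt x := rfl

lemma smul_hwVec {wt : Weight r} (x : U r) : x • hwVec wt = Submodule.Quotient.mk x := by
  rw [hwVec, ← Submodule.Quotient.mk_smul, smul_eq_mul, mul_one]

lemma hwCoeff_hwVec {d : ℤ} {wt : Weight r} (h : IsVacuum d wt) : hwCoeff h (hwVec wt) = 1 := by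
  rw [hwVec, hwCoeff_mk, expect_one]

lemma hwCoeff_F_smul {d : ℤ} {wt : Weight r} (h : IsVacuum d wt) (i : Fin r) (ν : Weight r)
    (z : L wt) : hwCoeff h (F i ν • z) = 0 := by
  obtain ⟨x, rfl⟩ := Submodule.Quotient.mk_surjective _ z
  rw [← Submodule.Quotient.mk_smul, hwCoeff_mk, smul_eq_mul, expect_F_mul h]

/-- Apart from `u` itself, such a vector is a sum of terms `F_i^{(m+1)} w`, each in the image of
`F_i`, where the coefficient vanishes. -/
lemma IsString.hwCoeff {d : ℤ} {wt : Weight r} (h : IsVacuum d wt) {s : L wt}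
    (hs : IsString wt s) : hwCoeff h s = 0 ∨ hwCoeff h s = 1 := by
  cases hs with
  | hw => exact Or.inr (hwCoeff_hwVec h)
  | step i x y hx hxy =>
    left
    obtain ⟨μ, N, w, -, -, rfl⟩ := hxy
    rw [map_sum]
    refine Finset.sum_eq_zero fun m _ => ?_
    rw [divF, powF, smul_assoc, map_smul, mul_smul, hwCoeff_F_smul, smul_zero]

lemma intDegree_hwCoeff_le {d : ℤ} {wt : Weight r} (h : IsVacuum d wt) {y : L wt}
    (hy : y ∈ lattice wt) : (hwCoeff h y).intDegree ≤ 0 := by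
  induction hy using AddSubgroup.closure_induction with
  | mem x hx =>
    obtain ⟨c, s, hc, hs, rfl⟩ := hx
    rw [map_smul]
    rcases hs.hwCoeff h with h1 | h1 <;> simp [h1, hc]
  | zero => simp
  | add x y _ _ hx hy =>
    rw [map_add]
    by_cases h1 : hwCoeff h y = 0
    · rwa [h1, add_zero]
    by_cases h2 : hwCoeff h x + hwCoeff h y = 0
    · simp [h2]
    exact (RatFunc.intDegree_add_le h1 h2).trans (max_le hx hy)
  | neg x _ hx => rwa [map_neg, RatFunc.intDegree_neg]

lemma intDegree_v_sq_add (e : ℚ) :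
    RatFunc.intDegree (v ^ 2 + 1 - algebraMap ℚ Qv e * v) = 2 := by
  have h : v ^ 2 + 1 - algebraMap ℚ Qv e * v = algebraMap (Polynomial ℚ) Qv
      (Polynomial.X ^ 2 + 1 - Polynomial.C e * Polynomial.X) := by
    simp [v]
  rw [h, RatFunc.intDegree_polynomial]
  norm_cast
  compute_degree!

lemma v_sq_add_one_ne_zero : v ^ 2 + 1 ≠ 0 := by
  intro h
  have := intDegree_v_sq_add 0
  rw [map_zero, zero_mul, sub_zero, h] at this
  simp at this

lemma qInt_two_ne_zero : qInt 2 ≠ 0 := by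
  intro h
  apply v_sq_add_one_ne_zero
  have h0 := v_ne_zero
  rw [qInt_two] at h
  field_simp at h
  simpa using h

lemma qInt_two_smul_hwVec_ne_zero {d : ℤ} {wt : Weight r} (h : IsVacuum d wt) :
    qInt 2 • hwVec wt ≠ 0 := by
  intro h1
  have h2 := congrArg (hwCoeff h) h1
  rw [map_smul, hwCoeff_hwVec, map_zero, smul_eq_mul, mul_one] at h2
  exact qInt_two_ne_zero h2

lemma qInt_two_smul_hwVec_notMem {d : ℤ} {wt : Weight r} (h : IsVacuum d wt) :
    qInt 2 • hwVec wt ∉ canonicalBasis wt := by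
  rintro ⟨-, -, s, hs, -, y, hy, h1⟩
  have h2 := congrArg (hwCoeff h) h1
  have h3 := intDegree_hwCoeff_le h hy
  rw [map_sub, map_smul, map_smul, hwCoeff_hwVec, smul_eq_mul, smul_eq_mul, mul_one,
    qInt_two] at h2
  have h0 := v_ne_zero
  -- Multiplying `v + v⁻¹ - e = v⁻¹ y` by `v` gives `y = v² + 1 - e v`, of degree 2, while the
  -- lattice allows degree at most 0.
  have key : ∀ e : ℚ, hwCoeff h s = algebraMap ℚ Qv e → False := by
    intro e he
    have h4 : hwCoeff h y = v ^ 2 + 1 - algebraMap ℚ Qv e * v := by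
      rw [he] at h2
      field_simp at h2
      linear_combination -h2
    rw [h4, intDegree_v_sq_add] at h3
    omega
  rcases hs.hwCoeff h with h4 | h4
  · exact key 0 (by rw [h4, map_zero])
  · exact key 1 (by rw [h4, map_one])

/-! ## Standard basis coordinates of products -/

lemma std_eq_zero {n : ℕ} {M : Matrix (Fin n) (Fin n) ℤ} {i j : Fin n} (hij : i ≠ j)
    (h : M i j < 0) : std M = 0 :=
  dif_neg fun hM => (hM i j hij).not_gt h

lemma std_apply {n : ℕ} (A B : Theta n) : std A.1 B = if A = B then 1 else 0 := by
  classical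
  rw [std_of_mem, Finsupp.single_apply]

lemma act_one_std (wt : Weight r) (M : Matrix (Fin (r + 1)) (Fin (r + 1)) ℤ) :
    act r (one wt) (std M) = if ro M = wt then std M else 0 := by
  rw [one, fone, act_gen, genOp, rowProj_std]

lemma act_E_std (i : Fin r) {wt : Weight r} {M : Matrix (Fin (r + 1)) (Fin (r + 1)) ℤ}
    (h : ro M = wt) : act r (E i wt) (std M) = ∑ u,
      (v ^ tail i.castSucc i.succ Finset.Ioi M u * qInt (M i.castSucc u + 1)) •
        std (M + shift i.castSucc i.succ u) := by
  rw [E, fE, act_gen, genOp, Module.End.mul_apply, rowProj_std, if_pos h,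
    moveOp_std Fin.castSucc_lt_succ.ne]
  simp only [moveCoeff_eq]

lemma act_F_std (i : Fin r) {wt : Weight r} {M : Matrix (Fin (r + 1)) (Fin (r + 1)) ℤ}
    (h : ro M = wt) : act r (F i wt) (std M) = ∑ u,
      (v ^ tail i.succ i.castSucc Finset.Iio M u * qInt (M i.succ u + 1)) •
        std (M + shift i.succ i.castSucc u) := by
  rw [F, fF, act_gen, genOp, Module.End.mul_apply, rowProj_std, if_pos h,
    moveOp_std Fin.castSucc_lt_succ.ne']
  simp only [moveCoeff_eq]

lemma ro_diagonal (wt : Weight r) : ro (Matrix.diagonal wt) = wt := by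
  funext i
  simp [ro, Matrix.diagonal_apply]

lemma co_diagonal (wt : Weight r) : co (Matrix.diagonal wt) = wt := by
  funext i
  simp [co, Matrix.diagonal_apply]

lemma co_add_shift {n : ℕ} (M : Matrix (Fin n) (Fin n) ℤ) (k l u : Fin n) :
    co (M + shift k l u) = co M := by
  funext j
  simp only [co, Matrix.add_apply, shift_apply, Finset.sum_add_distrib]
  by_cases h : u = j <;> simp [h]

/-- In every column other than the `i`-th, the move takes 1 from a zero off-diagonal entry, so the
symbol is zero. -/
lemma act_F_std_diagonal (i : Fin r) (wt : Weight r) :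
    act r (F i wt) (std (Matrix.diagonal wt))
      = std (Matrix.diagonal wt + shift i.succ i.castSucc i.castSucc) := by
  have hne : i.castSucc ≠ i.succ := Fin.castSucc_lt_succ.ne
  rw [act_F_std i (ro_diagonal wt), Finset.sum_eq_single i.castSucc]
  · have h1 : tail i.succ i.castSucc Finset.Iio (Matrix.diagonal wt) i.castSucc = 0 := by
      refine Finset.sum_eq_zero fun j hj => ?_
      rw [Finset.mem_Iio] at hj
      rw [Matrix.diagonal_apply_ne _ hj.ne',
        Matrix.diagonal_apply_ne _ (hj.trans Fin.castSucc_lt_succ).ne', sub_zero]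
    rw [h1, Matrix.diagonal_apply_ne _ hne.symm, zero_add, qInt_one, zpow_zero, mul_one, one_smul]
  · intro u _ hu
    rw [std_eq_zero hu.symm, smul_zero]
    simp [Matrix.diagonal_apply_ne _ hu.symm, shift_apply, hne.symm]
  · simp

/-- Two columns could contribute. The `i`-th one, which would give back the diagonal matrix, has
coefficient `[λ_i - 1 + 1] = [0]`; this is where `λ_i = 0` enters. -/
lemma act_E_std_shift (i : Fin r) {wt : Weight r} (hwt : wt i.castSucc = 0) :
    act r (E i (wt - root i)) (std (Matrix.diagonal wt + shift i.succ i.castSucc i.castSucc))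
      = std (Matrix.diagonal wt + shift i.succ i.castSucc i.castSucc
          + shift i.castSucc i.succ i.succ) := by
  have hne : i.castSucc ≠ i.succ := Fin.castSucc_lt_succ.ne
  have hro : ro (Matrix.diagonal wt + shift i.succ i.castSucc i.castSucc) = wt - root i := by
    rw [ro_add_shift, ro_diagonal, root]
    abel
  rw [act_E_std i hro, Finset.sum_eq_single i.succ]
  · have h1 : tail i.castSucc i.succ Finset.Ioi
        (Matrix.diagonal wt + shift i.succ i.castSucc i.castSucc) i.succ = 0 := by
      refine Finset.sum_eq_zero fun j hj => ?_
      rw [Finset.mem_Ioi] at hj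
      simp [shift_apply, Matrix.diagonal_apply_ne _ hj.ne, (Fin.castSucc_lt_succ.trans hj).ne]
    rw [h1]
    simp [shift_apply, hne, qInt_one]
  · intro u _ hu
    by_cases h : u = i.castSucc
    · subst h
      simp [shift_apply, hne.symm, hwt, qInt_zero]
    · rw [std_eq_zero hu.symm, smul_zero]
      simp [Matrix.diagonal_apply_ne _ hu.symm, shift_apply, hne, Ne.symm h]
  · simp

/-! ### The element `E_i F_i 1_λ` and the proof of (1) -/

/-- The index of the standard basis element `E_i F_i 1_wt`, if the `i`-th entry of `wt` is `0`. -/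
def efMatrix (i : Fin r) (wt : Weight r) : Theta (r + 1) :=
  ⟨Matrix.diagonal wt + shift i.succ i.castSucc i.castSucc + shift i.castSucc i.succ i.succ, by
    have hne : i.castSucc ≠ i.succ := Fin.castSucc_lt_succ.ne
    intro a b hab
    simp only [Matrix.add_apply, shift_apply, Matrix.diagonal_apply_ne _ hab]
    split_ifs <;> simp_all⟩

/-- A product of generators is bar-invariant, and this one is a single standard basis element, so
the triangularity conditions hold with no lower terms. -/
lemma isBLM_E_mul_F (i : Fin r) {wt : Weight r} (hwt : wt i.castSucc = 0) :
    IsBLM (efMatrix i wt) (E i (wt - root i) * F i wt) := by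
  have hco : co (efMatrix i wt).1 = wt := by
    rw [efMatrix, co_add_shift, co_add_shift, co_diagonal]
  have hcoords : coords wt (E i (wt - root i) * F i wt) = std (efMatrix i wt).1 := by
    rw [coords, map_mul, Module.End.mul_apply, act_F_std_diagonal, act_E_std_shift i hwt,
      efMatrix]
  refine ⟨?_, ?_, ?_, fun B hB => ?_⟩
  · rw [hco, mul_assoc, F_mul_one]
  · rw [map_mul, bar_E, bar_F]
  · rw [hco, hcoords, std_apply, if_pos rfl]
  · rw [hco, hcoords, std_apply, if_neg hB.symm]
    exact ⟨⟨0, by simp⟩, fun h => (h rfl).elim⟩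

lemma E_mul_F_smul_hwVec {d : ℤ} {wt : Weight r} (h : IsVacuum d wt) (i : Fin r) :
    (E i (wt - root i) * F i wt) • hwVec wt
      = qInt (wt i.castSucc - wt i.succ) • hwVec wt := by
  rw [smul_hwVec, hwVec, ← Submodule.Quotient.mk_smul, Submodule.Quotient.eq]
  refine vermaIdeal_le_simpleIdeal h ?_
  have e : E i (wt - root i) * F i wt - qInt (wt i.castSucc - wt i.succ) • (1 : U r)
      = F i (wt + root i) * E i wt - qInt (wt i.castSucc - wt i.succ) • (1 - one wt) := by
    rw [E_mul_F_same, smul_sub]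
    abel
  refine (congrArg (· ∈ vermaIdeal wt) e).mpr ?_
  exact sub_mem ((vermaIdeal wt).smul_mem _ (E_mem_vermaIdeal i wt))
    (((vermaIdeal wt).restrictScalars Qv).smul_mem _ (one_sub_one_mem_vermaIdeal wt))

theorem exists_isBLM_smul_hwVec_notMem (r : ℕ) (hr : 1 ≤ r) :
    ∃ (wt : Weight r) (A : Theta (r + 1)) (C : U r),
      Dominant wt ∧ IsBLM A C ∧ C • hwVec wt ≠ 0 ∧ C • hwVec wt ∉ canonicalBasis wt := by
  obtain ⟨k, rfl⟩ := Nat.exists_eq_add_of_le' hr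
  -- The entry `0` makes `E F 1_λ` a single symbol. The entries `-2` make the weight a vacuum for `d
  -- = -2` and the first difference equal to `2`, so that the scalar is `[2]`.
  let wt : Weight (k + 1) := Fin.cons 0 fun _ => -2
  have hvac : IsVacuum (-2) wt := fun i => rfl
  have h := E_mul_F_smul_hwVec hvac 0
  have h2 : wt (Fin.castSucc 0) - wt (Fin.succ 0) = 2 := rfl
  rw [h2] at h
  refine ⟨wt, _, _, fun i => ?_, isBLM_E_mul_F (wt := wt) 0 rfl, ?_, ?_⟩
  · rw [hvac i]
    refine Fin.cases ?_ (fun j => ?_) i.castSucc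
    · exact neg_nonpos.mpr zero_le_two
    · exact le_rfl
  · rw [h]
    exact qInt_two_smul_hwVec_ne_zero hvac
  · rw [h]
    exact qInt_two_smul_hwVec_notMem hvac

/-! ## Bar-invariant scalars -/

lemma aeval_v_eq (p : Polynomial ℤ) : Polynomial.aeval v p
    = algebraMap (Polynomial ℚ) Qv (p.map (Int.castRingHom ℚ)) := by
  induction p using Polynomial.induction_on' with
  | add p q hp hq => simp [hp, hq]
  | monomial n a => simp [v, ← Polynomial.C_mul_X_pow_eq_monomial]

lemma aeval_v_injective : Function.Injective (Polynomial.aeval (R := ℤ) v) := by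
  intro p q h
  rw [aeval_v_eq, aeval_v_eq] at h
  exact Polynomial.map_injective _ Int.cast_injective (RatFunc.algebraMap_injective ℚ h)

lemma barQ_aeval_inv (p : Polynomial ℤ) :
    barQ (Polynomial.aeval v⁻¹ p) = Polynomial.aeval v p := by
  induction p using Polynomial.induction_on' with
  | add p q hp hq => simp [hp, hq]
  | monomial n a => simp [Polynomial.aeval_monomial, barQ_v]

/-- A bar-invariant element of `v⁻¹ ℤ[v⁻¹]` is zero. -/
lemma eq_zero_of_barQ_eq {c : Qv} (hc : c ∈ vInvZ) (h : barQ c = c) : c = 0 := by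
  obtain ⟨p, rfl⟩ := hc
  have h0 := v_ne_zero
  rw [map_mul, map_inv₀, barQ_v, inv_inv, barQ_aeval_inv] at h
  let _ : Invertible v⁻¹ := invertibleOfNonzero (inv_ne_zero h0)
  have h1 := Polynomial.eval₂_reverse_mul_pow (algebraMap ℤ Qv) v⁻¹ p
  rw [invOf_eq_inv, inv_inv, ← Polynomial.aeval_def, ← Polynomial.aeval_def] at h1
  rw [← h1] at h
  -- Bar-invariance says `v⁻¹ p(v⁻¹) = v p(v)`. Multiplied by `v^{deg p + 1}` it becomes an identity
  -- of polynomials, impossible for `p ≠ 0`: the reverse has degree at most `deg p`, the other side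
  -- `2 deg p + 2`.
  have h2 : Polynomial.aeval v p.reverse
      = Polynomial.aeval v (p * Polynomial.X ^ (p.natDegree + 2)) := by
    rw [map_mul, map_pow, Polynomial.aeval_X, pow_add]
    have h6 : v ^ p.natDegree ≠ 0 := pow_ne_zero _ h0
    rw [inv_pow] at h
    field_simp at h
    linear_combination -h
  have h3 := aeval_v_injective h2
  by_cases hp : p = 0
  · simp [hp]
  · have h4 := p.reverse_natDegree_le
    rw [h3, Polynomial.natDegree_mul_X_pow _ hp] at h4
    omega

lemma zero_mem_vInvZ : (0 : Qv) ∈ vInvZ := ⟨0, by simp⟩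

lemma add_mem_vInvZ {a b : Qv} (ha : a ∈ vInvZ) (hb : b ∈ vInvZ) : a + b ∈ vInvZ := by
  obtain ⟨p, rfl⟩ := ha
  obtain ⟨q, rfl⟩ := hb
  exact ⟨p + q, by rw [map_add, mul_add]⟩

lemma neg_mem_vInvZ {a : Qv} (ha : a ∈ vInvZ) : -a ∈ vInvZ := by
  obtain ⟨p, rfl⟩ := ha
  exact ⟨-p, by rw [map_neg, mul_neg]⟩

lemma v_zpow_mem_vInvZ {k : ℤ} (hk : k < 0) : v ^ k ∈ vInvZ := by
  obtain ⟨n, rfl⟩ : ∃ n : ℕ, k = -((n : ℤ) + 1) := ⟨(-k - 1).toNat, by omega⟩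
  refine ⟨Polynomial.X ^ n, ?_⟩
  rw [map_pow, Polynomial.aeval_X, ← pow_succ', zpow_neg, inv_pow]
  norm_cast

/-- For `q > 0` the highest exponent of `v` in `v^k [q]` is `k + q - 1`, so the hypothesis makes all
exponents negative. -/
lemma v_zpow_mul_qInt_mem_vInvZ (q : ℕ) :
    ∀ k : ℤ, k + q ≤ 0 → v ^ k * qInt q ∈ vInvZ := by
  induction q with
  | zero =>
    intro k _
    simpa [qInt_zero] using zero_mem_vInvZ
  | succ q ih =>
    intro k hk
    push_cast at hk ⊢
    have h := qInt_add q 1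
    rw [qInt_one, mul_one, zpow_one] at h
    rw [← h, mul_add, ← mul_assoc, ← zpow_add_one₀ v_ne_zero, ← zpow_add₀ v_ne_zero]
    exact add_mem_vInvZ (ih _ (by omega)) (v_zpow_mem_vInvZ (by omega))

lemma v_pow_ne_one {n : ℕ} (hn : n ≠ 0) : v ^ n ≠ 1 := by
  intro h
  have h1 : Polynomial.aeval (R := ℤ) v (Polynomial.X ^ n) = Polynomial.aeval (R := ℤ) v 1 := by
    simpa only [map_pow, Polynomial.aeval_X, map_one] using h
  have h2 := congrArg Polynomial.natDegree (aeval_v_injective h1)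
  simp [hn] at h2

lemma qInt_succ_ne_zero (n : ℕ) : qInt (n + 1) ≠ 0 := by
  have h0 := v_ne_zero
  refine div_ne_zero (fun h => ?_) v_sub_inv_ne_zero
  refine v_pow_ne_one (n := 2 * (n + 1)) (by omega) ?_
  rw [sub_eq_zero, zpow_neg] at h
  norm_cast at h
  have h1 : v ^ (n + 1) ≠ 0 := pow_ne_zero _ h0
  rw [two_mul, pow_add]
  nth_rewrite 1 [h]
  exact inv_mul_cancel₀ h1

lemma qFact_ne_zero (a : ℕ) : qFact a ≠ 0 :=
  Finset.prod_ne_zero_iff.mpr fun k _ => qInt_succ_ne_zero k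

lemma qFact_succ (a : ℕ) : qFact (a + 1) = qFact a * qInt (a + 1) := Finset.prod_range_succ _ _

lemma barQ_qFact (a : ℕ) : barQ (qFact a) = qFact a := by
  simp [qFact, map_prod, barQ_qInt]

lemma v_zpow_mul_br (m : ℤ) : v ^ (1 - m) * br m = qInt m := by
  have h0 := v_ne_zero
  have h1 : v ^ 2 - 1 ≠ 0 := sub_ne_zero.mpr v_sq_ne_one
  have h5 : v - v⁻¹ = (v ^ 2 - 1) / v := by field_simp
  have h4 : v ^ m ≠ 0 := zpow_ne_zero _ h0
  rw [br, qInt, zpow_sub₀ h0, zpow_one, two_mul, zpow_add₀ h0, zpow_neg, h5]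
  field_simp

/-! ## Divided powers -/

lemma one_mul_powE (i : Fin r) (a : ℕ) (wt : Weight r) :
    one (wt + (a : ℤ) • root i) * powE i a wt = powE i a wt := by
  cases a with
  | zero => simp [powE, one_mul_one]
  | succ a =>
    rw [powE, ← mul_assoc]
    congr 1
    convert one_mul_E i (wt + (a : ℤ) • root i) using 3
    push_cast
    rw [add_smul, one_smul, add_assoc]

lemma one_mul_powF (i : Fin r) (a : ℕ) (wt : Weight r) :
    one (wt - (a : ℤ) • root i) * powF i a wt = powF i a wt := by
  cases a with
  | zero => simp [powF, one_mul_one]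
  | succ a =>
    rw [powF, ← mul_assoc]
    congr 1
    convert one_mul_F i (wt - (a : ℤ) • root i) using 3
    push_cast
    rw [add_smul, one_smul, sub_sub]

lemma powF_mul_one (i : Fin r) (a : ℕ) (wt : Weight r) :
    powF i a wt * one wt = powF i a wt := by
  induction a with
  | zero => exact one_mul_one wt
  | succ a ih => rw [powF, mul_assoc, ih]

lemma bar_powE (i : Fin r) (a : ℕ) (wt : Weight r) : bar r (powE i a wt) = powE i a wt := by
  induction a with
  | zero => exact bar_one wt
  | succ a ih => rw [powE, map_mul, bar_E, ih]

lemma bar_powF (i : Fin r) (a : ℕ) (wt : Weight r) : bar r (powF i a wt) = powF i a wt := by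
  induction a with
  | zero => exact bar_one wt
  | succ a ih => rw [powF, map_mul, bar_F, ih]

lemma bar_divF (i : Fin r) (a : ℕ) (wt : Weight r) : bar r (divF i a wt) = divF i a wt := by
  rw [divF, bar_smul, map_inv₀, barQ_qFact, bar_powF]

lemma root_castSucc_self (i : Fin r) : root i i.castSucc = 1 := by simp [root_castSucc]

lemma root_succ_self (i : Fin r) : root i i.succ = -1 := by simp [root_succ]

/-- The usual `sl₂` computation in a Verma module. With `m = λ_i - λ_{i+1}`, the induction step is
`[a+2] [m-a-1] = [a+1] [m-a] + [m-2a-2]`. -/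
lemma E_mul_powF_sub_mem (i : Fin r) (wt : Weight r) (a : ℕ) :
    E i (wt - ((a + 1 : ℕ) : ℤ) • root i) * powF i (a + 1) wt
      - (qInt (a + 1) * qInt (wt i.castSucc - wt i.succ - a)) • powF i a wt
        ∈ (vermaIdeal wt).restrictScalars Qv := by
  induction a with
  | zero =>
    have e : E i (wt - ((0 + 1 : ℕ) : ℤ) • root i) * powF i (0 + 1) wt
        - (qInt ((0 : ℕ) + 1) * qInt (wt i.castSucc - wt i.succ - (0 : ℕ))) • powF i 0 wt
        = F i (wt + root i) * E i wt := by
      have h := E_mul_F_same i wt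
      simp [powF, F_mul_one, qInt_one, h]
    rw [e]
    exact (vermaIdeal wt).smul_mem _ (E_mem_vermaIdeal i wt)
  | succ a ih =>
    set κ := wt - ((a + 1 : ℕ) : ℤ) • root i with hκ
    have e1 : wt - ((a + 1 + 1 : ℕ) : ℤ) • root i = κ - root i := by
      rw [hκ]; push_cast; rw [add_smul, one_smul, sub_sub]
    have e2 : wt - (a : ℤ) • root i = κ + root i := by
      rw [hκ]; push_cast; rw [add_smul, one_smul]; abel
    have e3 : κ i.castSucc - κ i.succ = wt i.castSucc - wt i.succ - (a + 1 : ℕ) - (a + 1 : ℕ) := by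
      simp only [hκ, Pi.sub_apply, Pi.smul_apply, root_castSucc_self, root_succ_self, smul_eq_mul]
      push_cast; ring
    have e4 := qInt_add_one_mul (wt i.castSucc - wt i.succ - (a + 1 : ℕ)) (a + 1 : ℕ)
    have e5 : wt i.castSucc - wt i.succ - (a + 1 : ℕ) + 1 = wt i.castSucc - wt i.succ - a := by
      push_cast; ring
    rw [e1, powF, ← mul_assoc, ← hκ, E_mul_F_same, e3, e4, e5, add_smul, add_mul, smul_mul_assoc,
      hκ, one_mul_powF, ← hκ, add_sub_add_right_eq_sub, mul_assoc]
    have h1 := (vermaIdeal wt).smul_mem (F i (κ + root i)) ih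
    rw [smul_eq_mul, mul_sub, mul_smul_comm] at h1
    have h2 : F i (κ + root i) * powF i a wt = powF i (a + 1) wt := by rw [powF, e2]
    rw [h2] at h1
    rw [mul_comm (qInt _)]
    push_cast
    exact h1

lemma E_mul_divF_smul_hwVec {d : ℤ} {wt : Weight r} (h : IsVacuum d wt) (i : Fin r) (a : ℕ) :
    (E i (wt - ((a + 1 : ℕ) : ℤ) • root i) * divF i (a + 1) wt) • hwVec wt
      = qInt (wt i.castSucc - wt i.succ - a) • (divF i a wt • hwVec wt) := by
  have h1 : (E i (wt - ((a + 1 : ℕ) : ℤ) • root i) * powF i (a + 1) wt) • hwVec wt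
      = ((qInt (a + 1) * qInt (wt i.castSucc - wt i.succ - a)) • powF i a wt) • hwVec wt := by
    rw [smul_hwVec, smul_hwVec, Submodule.Quotient.eq]
    exact vermaIdeal_le_simpleIdeal h (E_mul_powF_sub_mem i wt a)
  have h2 := qInt_succ_ne_zero a
  have h3 := qFact_ne_zero a
  rw [divF, mul_smul_comm, smul_assoc, h1, ← smul_assoc, ← smul_assoc, divF,
    ← smul_assoc (qInt _) ((qFact a)⁻¹ • powF i a wt), ← smul_assoc (qInt _) (qFact a)⁻¹,
    smul_eq_mul, smul_eq_mul, qFact_succ]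
  congr 2
  field_simp

/-! ## The standard basis in rank one -/

/-- The matrices with column sums `wt`. -/
def mat (wt : Weight 1) (i j : ℤ) : Matrix (Fin 2) (Fin 2) ℤ := !![wt 0 - j, i; j, wt 1 - i]

lemma mat_inj {wt : Weight 1} {i j i' j' : ℤ} (h : mat wt i j = mat wt i' j') :
    i = i' ∧ j = j' :=
  ⟨congrFun (congrFun h 0) 1, congrFun (congrFun h 1) 0⟩

lemma inTheta_mat (wt : Weight 1) {i j : ℤ} (hi : 0 ≤ i) (hj : 0 ≤ j) : InTheta (mat wt i j) := by
  intro a b hab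
  fin_cases a <;> fin_cases b <;> simp_all [mat]

lemma mat_zero_zero (wt : Weight 1) : mat wt 0 0 = Matrix.diagonal wt := by
  ext a b
  fin_cases a <;> fin_cases b <;> simp [mat]

lemma ro_mat (wt : Weight 1) (i j : ℤ) : ro (mat wt i j) = wt - j • root 0 + i • root 0 := by
  funext a
  fin_cases a <;> simp [ro, mat, root]
  ring

lemma co_mat (wt : Weight 1) (i j : ℤ) : co (mat wt i j) = wt := by
  funext a
  fin_cases a <;> simp [co, mat]

lemma act_E_std_mat (wt : Weight 1) (i j : ℤ) :
    act 1 (E 0 (wt - j • root 0 + i • root 0)) (std (mat wt i j))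
      = (v ^ (2 * i - wt 1) * qInt (wt 0 - j + 1)) • std (mat wt i (j - 1))
        + qInt (i + 1) • std (mat wt (i + 1) j) := by
  have e1 : mat wt i j + shift (Fin.castSucc 0) (Fin.succ 0) 0 = mat wt i (j - 1) := by
    ext a b
    fin_cases a <;> fin_cases b <;> simp [mat, shift_apply] <;> ring
  have e2 : mat wt i j + shift (Fin.castSucc 0) (Fin.succ 0) 1 = mat wt (i + 1) j := by
    ext a b
    fin_cases a <;> fin_cases b <;> simp [mat, shift_apply] <;> ring
  have t1 : tail (Fin.castSucc 0) (Fin.succ 0) Finset.Ioi (mat wt i j) 0 = 2 * i - wt 1 := by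
    have : Finset.Ioi (0 : Fin 2) = {1} := rfl
    simp [tail, this, mat]
    ring
  have t2 : tail (Fin.castSucc 0) (Fin.succ 0) Finset.Ioi (mat wt i j) 1 = 0 := by
    have : Finset.Ioi (1 : Fin 2) = ∅ := rfl
    simp [tail, this]
  rw [act_E_std 0 (ro_mat wt i j), Fin.sum_univ_two, e1, e2, t1, t2, zpow_zero, one_mul]
  rfl

lemma act_F_std_mat_zero (wt : Weight 1) (j : ℤ) :
    act 1 (F 0 (wt - j • root 0)) (std (mat wt 0 j)) = qInt (j + 1) • std (mat wt 0 (j + 1)) := by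
  have hro : ro (mat wt 0 j) = wt - j • root 0 := by rw [ro_mat, zero_smul, add_zero]
  have e1 : mat wt 0 j + shift (Fin.succ 0) (Fin.castSucc 0) 0 = mat wt 0 (j + 1) := by
    ext a b
    fin_cases a <;> fin_cases b <;> simp [mat, shift_apply] <;> ring
  have e2 : std (mat wt 0 j + shift (Fin.succ 0) (Fin.castSucc 0) 1) = 0 :=
    std_eq_zero (i := 0) (j := 1) (by decide) (by simp [mat, shift_apply])
  have t1 : tail (Fin.succ 0) (Fin.castSucc 0) Finset.Iio (mat wt 0 j) 0 = 0 := by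
    have : Finset.Iio (0 : Fin 2) = ∅ := rfl
    simp [tail, this]
  rw [act_F_std 0 hro, Fin.sum_univ_two, e1, e2, t1, zpow_zero, one_mul, smul_zero, add_zero]
  rfl

lemma coords_powF (wt : Weight 1) (j : ℕ) :
    coords wt (powF 0 j wt) = qFact j • std (mat wt 0 j) := by
  induction j with
  | zero =>
    rw [powF, coords, act_one_std, if_pos (ro_diagonal wt), Nat.cast_zero, mat_zero_zero]
    simp [qFact]
  | succ j ih =>
    rw [coords] at ih
    rw [powF, coords, map_mul, Module.End.mul_apply, ih, map_smul, act_F_std_mat_zero, smul_smul,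
      ← qFact_succ, Nat.cast_succ]

lemma coords_divF (wt : Weight 1) (j : ℕ) : coords wt (divF 0 j wt) = std (mat wt 0 j) := by
  have h := coords_powF wt j
  rw [coords] at h
  rw [divF, coords, map_smul, LinearMap.smul_apply, h, smul_smul,
    inv_mul_cancel₀ (qFact_ne_zero j), one_smul]

/-! ### The filtration by the sum of the off-diagonal entries -/

/-- The span of the `[A]` of low degree. -/
def lowSpan (wt : Weight 1) (N : ℤ) : Submodule Qv (V 2) :=
  Submodule.span Qv {x | ∃ i j : ℤ, i + j < N ∧ x = std (mat wt i j)}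

lemma std_mem_lowSpan (wt : Weight 1) {i j N : ℤ} (h : i + j < N) :
    std (mat wt i j) ∈ lowSpan wt N :=
  Submodule.subset_span ⟨i, j, h, rfl⟩

/-- Of the two terms in `act_E_std_mat`, one lowers the degree `i + j` by one and the other raises
it by one. -/
lemma act_E_mem_lowSpan (wt μ : Weight 1) {N : ℤ} {x : V 2} (hx : x ∈ lowSpan wt N) :
    act 1 (E 0 μ) x ∈ lowSpan wt (N + 1) := by
  induction hx using Submodule.span_induction with
  | mem x hx =>
    obtain ⟨i, j, h, rfl⟩ := hx
    by_cases e : ro (mat wt i j) = μ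
    · rw [← e, ro_mat, act_E_std_mat]
      exact add_mem (Submodule.smul_mem _ _ (std_mem_lowSpan wt (by omega)))
        (Submodule.smul_mem _ _ (std_mem_lowSpan wt (by omega)))
    · rw [← E_mul_one, map_mul, Module.End.mul_apply, act_one_std, if_neg e, map_zero]
      exact zero_mem _
  | zero => simp
  | add x y _ _ hx hy => simpa using add_mem hx hy
  | smul c x _ hx => simpa using Submodule.smul_mem _ c hx

lemma apply_of_mem_lowSpan {wt : Weight 1} {N : ℤ} {x : V 2} (hx : x ∈ lowSpan wt N)
    (B : Theta 2) {i j : ℤ} (hB : B.1 = mat wt i j) (h : N ≤ i + j) : x B = 0 := by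
  induction hx using Submodule.span_induction with
  | mem x hx =>
    obtain ⟨i', j', h', rfl⟩ := hx
    by_cases e : InTheta (mat wt i' j')
    · rw [std_apply ⟨_, e⟩, if_neg]
      rintro rfl
      obtain ⟨rfl, rfl⟩ := mat_inj hB
      omega
    · rw [std, dif_neg e, Finsupp.zero_apply]
  | zero => rfl
  | add x y _ _ hx hy => rw [Finsupp.add_apply, hx, hy, add_zero]
  | smul c x _ hx => rw [Finsupp.smul_apply, hx, smul_zero]

/-- The monomial `E^i F^j 1_wt`. -/
def mono (wt : Weight 1) (s : ℕ × ℕ) : U 1 :=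
  powE 0 s.1 (wt - (s.2 : ℤ) • root 0) * powF 0 s.2 wt

/-- Triangularity: `F^j 1_λ` is exactly `[j]!` times a symbol, and each `E` has a single
degree-raising term, whose coefficients multiply to `[i]!`. -/
lemma coords_mono_sub_mem (wt : Weight 1) (s : ℕ × ℕ) :
    coords wt (mono wt s) - (qFact s.1 * qFact s.2) • std (mat wt s.1 s.2)
      ∈ lowSpan wt (s.1 + s.2) := by
  obtain ⟨i, j⟩ := s
  simp only
  induction i with
  | zero =>
    rw [mono, powE, one_mul_powF, coords_powF]
    simp [qFact]
  | succ i ih =>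
    rw [coords] at ih
    rw [mono, powE, mul_assoc, coords, map_mul, Module.End.mul_apply]
    change act 1 _ (act 1 (mono wt (i, j)) _) - _ ∈ _
    have h := act_E_mem_lowSpan wt (wt - (j : ℤ) • root 0 + (i : ℤ) • root 0) ih
    rw [map_sub, map_smul, act_E_std_mat, smul_add, smul_smul _ (qInt _)] at h
    have e : qFact (i + 1) * qFact j = qFact i * qFact j * qInt (i + 1) := by
      rw [qFact_succ]; ring
    have e' : ((i + 1 : ℕ) : ℤ) + j = i + j + 1 := by push_cast; ring
    rw [e, e', Nat.cast_succ]
    have h1 : std (mat wt i (j - 1)) ∈ lowSpan wt (i + j + 1) := std_mem_lowSpan wt (by omega)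
    have h2 := add_mem h (Submodule.smul_mem _ (qFact i * qFact j) (Submodule.smul_mem _
      (v ^ (2 * (i : ℤ) - wt 1) * qInt (wt 0 - j + 1)) h1))
    convert h2 using 1
    abel

lemma one_mul_mono (wt : Weight 1) (s : ℕ × ℕ) :
    one (wt - (s.2 : ℤ) • root 0 + (s.1 : ℤ) • root 0) * mono wt s = mono wt s := by
  rw [mono, ← mul_assoc, one_mul_powE]

lemma bar_mono (wt : Weight 1) (s : ℕ × ℕ) : bar 1 (mono wt s) = mono wt s := by
  rw [mono, map_mul, bar_powE, bar_powF]

/-! ### Monomials span `U̇ 1_λ`, and uniqueness of the BLM element in rank one -/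

/-- The span of the monomials `E^i F^j 1_wt`. -/
def monoSpan (wt : Weight 1) : Submodule Qv (U 1) := Submodule.span Qv (Set.range (mono wt))

lemma mono_mem_monoSpan (wt : Weight 1) (s : ℕ × ℕ) : mono wt s ∈ monoSpan wt :=
  Submodule.subset_span ⟨s, rfl⟩

lemma mul_mem_monoSpan_of_forall (wt : Weight 1) (a : U 1)
    (h : ∀ s, a * mono wt s ∈ monoSpan wt) : ∀ x ∈ monoSpan wt, a * x ∈ monoSpan wt := by
  have h1 : monoSpan wt ≤ (monoSpan wt).comap (LinearMap.mulLeft Qv a) := by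
    rw [monoSpan, Submodule.span_le]
    rintro _ ⟨s, rfl⟩
    exact h s
  exact fun x hx => h1 hx

lemma one_mul_mem_monoSpan (wt ν : Weight 1) : ∀ x ∈ monoSpan wt, one ν * x ∈ monoSpan wt := by
  refine mul_mem_monoSpan_of_forall wt _ fun s => ?_
  by_cases h : ν = wt - (s.2 : ℤ) • root 0 + (s.1 : ℤ) • root 0
  · rw [h, one_mul_mono]
    exact mono_mem_monoSpan wt s
  · rw [one_mul_of_one_mul (one_mul_mono wt s) h]
    exact zero_mem _

lemma E_mul_mem_monoSpan (wt : Weight 1) (i : Fin 1) (ν : Weight 1) :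
    ∀ x ∈ monoSpan wt, E i ν * x ∈ monoSpan wt := by
  obtain rfl : i = 0 := Subsingleton.elim _ _
  refine mul_mem_monoSpan_of_forall wt _ fun s => ?_
  by_cases h : ν = wt - (s.2 : ℤ) • root 0 + (s.1 : ℤ) • root 0
  · rw [h, mono, ← mul_assoc]
    exact mono_mem_monoSpan wt (s.1 + 1, s.2)
  · rw [E_mul_of_one_mul 0 (one_mul_mono wt s) h]
    exact zero_mem _

/-- `F` is moved to the right past the powers of `E`, by induction on their number. The commutators
are scalar multiples of idempotents and leave shorter monomials. -/
lemma F_mul_mem_monoSpan (wt : Weight 1) (i : Fin 1) (ν : Weight 1) :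
    ∀ x ∈ monoSpan wt, F i ν * x ∈ monoSpan wt := by
  obtain rfl : i = 0 := Subsingleton.elim _ _
  refine mul_mem_monoSpan_of_forall wt _ fun s => ?_
  obtain ⟨k, j⟩ := s
  by_cases h : ν = wt - (j : ℤ) • root 0 + (k : ℤ) • root 0
  · induction k generalizing ν with
    | zero =>
      have e : F 0 ν * mono wt (0, j) = mono wt (0, j + 1) := by
        rw [h, Nat.cast_zero, zero_smul, add_zero]
        simp only [mono, powE, one_mul_powF]
        rfl
      rw [e]
      exact mono_mem_monoSpan wt _
    | succ k ih =>
      set κ := wt - (j : ℤ) • root 0 + (k : ℤ) • root 0 with hκ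
      have e1 : ν = κ + root 0 := by
        rw [h, hκ]; push_cast; rw [add_smul, one_smul, add_assoc]
      have e2 : mono wt (k + 1, j) = E 0 κ * mono wt (k, j) := by
        rw [mono, mono, powE, mul_assoc]
      have e3 : F 0 (κ + root 0) * E 0 κ
          = E 0 (κ - root 0) * F 0 κ - qInt (κ (Fin.castSucc 0) - κ (Fin.succ 0)) • one κ := by
        rw [E_mul_F_same, add_sub_cancel_right]
      rw [e1, e2, ← mul_assoc, e3, sub_mul, mul_assoc, smul_mul_assoc]
      exact sub_mem (E_mul_mem_monoSpan wt 0 _ _ (ih κ rfl))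
        (Submodule.smul_mem _ _ (one_mul_mem_monoSpan wt _ _ (mono_mem_monoSpan wt _)))
  · rw [F_mul_of_one_mul 0 (one_mul_mono wt (k, j)) h]
    exact zero_mem _

lemma mem_monoSpan {wt : Weight 1} {x : U 1} (hx : x * one wt = x) : x ∈ monoSpan wt := by
  rw [← hx]
  refine mul_mem_of_gen_mul_mem (monoSpan wt) (one_mul_mem_monoSpan wt) (E_mul_mem_monoSpan wt)
    (F_mul_mem_monoSpan wt) x _ ?_
  have e : one wt = mono wt (0, 0) := by
    simp [mono, powE, powF, one_mul_one]
  rw [e]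
  exact mono_mem_monoSpan wt _

/-- The coordinate of a combination of monomials at a monomial of maximal degree. -/
lemma coords_sum_mono_apply (wt : Weight 1) (T : Finset (ℕ × ℕ)) (c : ℕ × ℕ → Qv) {s : ℕ × ℕ}
    (hs : s ∈ T) (hmax : ∀ t ∈ T, t.1 + t.2 ≤ s.1 + s.2) (B : Theta 2)
    (hB : B.1 = mat wt s.1 s.2) :
    coords wt (∑ t ∈ T, c t • mono wt t) B = c s * (qFact s.1 * qFact s.2) := by
  rw [coords, map_sum, LinearMap.sum_apply, Finsupp.finsetSum_apply,
    Finset.sum_eq_single_of_mem s hs]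
  · rw [map_smul, LinearMap.smul_apply, Finsupp.smul_apply, smul_eq_mul]
    have h := apply_of_mem_lowSpan (coords_mono_sub_mem wt s) B hB le_rfl
    rw [coords, Finsupp.sub_apply, Finsupp.smul_apply, ← hB, std_apply, if_pos rfl, smul_eq_mul,
      mul_one, sub_eq_zero] at h
    rw [h]
  · intro t ht hts
    rw [map_smul, LinearMap.smul_apply, Finsupp.smul_apply, smul_eq_mul]
    have h := apply_of_mem_lowSpan (coords_mono_sub_mem wt t) B hB
      (by exact_mod_cast hmax t ht)
    rw [coords, Finsupp.sub_apply, Finsupp.smul_apply,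
      std_apply ⟨_, inTheta_mat wt (Nat.cast_nonneg _) (Nat.cast_nonneg _)⟩, if_neg, smul_zero,
      sub_zero] at h
    · rw [h, mul_zero]
    · rintro rfl
      obtain ⟨h1, h2⟩ := mat_inj hB
      exact hts (Prod.ext (by exact_mod_cast h1) (by exact_mod_cast h2))

/-- A bar-invariant element of `U̇ 1_wt` with coordinates in `v⁻¹ ℤ[v⁻¹]` vanishes. -/
lemma eq_zero_of_bar_eq {wt : Weight 1} {x : U 1} (hx : x * one wt = x) (hbar : bar 1 x = x)
    (hc : ∀ B, coords wt x B ∈ vInvZ) : x = 0 := by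
  obtain ⟨c, rfl⟩ := Finsupp.mem_span_range_iff_exists_finsupp.mp (mem_monoSpan hx)
  rw [Finsupp.sum] at hbar hc ⊢
  by_contra hne
  have hT : c.support.Nonempty := by
    rw [Finset.nonempty_iff_ne_empty]
    intro h
    exact hne (by rw [h, Finset.sum_empty])
  -- At a monomial of maximal degree the coordinate is the coefficient times `[i]! [j]!`, with no
  -- contribution from the others. Applying bar conjugates only the coefficients, so this coordinate
  -- is bar-invariant, hence zero. Linear independence of the monomials is not needed.
  obtain ⟨s, hs, hmax⟩ := c.support.exists_max_image (fun t => t.1 + t.2) hT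
  let B : Theta 2 := ⟨mat wt s.1 s.2, inTheta_mat wt (Nat.cast_nonneg _) (Nat.cast_nonneg _)⟩
  have h1 := coords_sum_mono_apply wt c.support c hs hmax B rfl
  have h2 := coords_sum_mono_apply wt c.support (fun t => barQ (c t)) hs hmax B rfl
  have h3 : bar 1 (∑ t ∈ c.support, c t • mono wt t)
      = ∑ t ∈ c.support, barQ (c t) • mono wt t := by
    rw [map_sum]
    exact Finset.sum_congr rfl fun t _ => by rw [bar_smul, bar_mono]
  rw [hbar] at h3
  rw [← h3, h1] at h2
  have h4 := hc B
  rw [h1] at h4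
  have h5 := eq_zero_of_barQ_eq h4 (by rw [map_mul, map_mul, barQ_qFact, barQ_qFact, h2])
  rw [mul_eq_zero, or_iff_left (mul_ne_zero (qFact_ne_zero _) (qFact_ne_zero _))] at h5
  exact Finsupp.mem_support_iff.mp hs h5

lemma IsBLM.unique {A : Theta 2} {X Y : U 1} (hX : IsBLM A X) (hY : IsBLM A Y) : X = Y := by
  obtain ⟨x1, x2, x3, x4⟩ := hX
  obtain ⟨y1, y2, y3, y4⟩ := hY
  rw [← sub_eq_zero]
  refine eq_zero_of_bar_eq (wt := co A.1) (by rw [sub_mul, x1, y1]) (by rw [map_sub, x2, y2])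
    fun B => ?_
  have h : coords (co A.1) (X - Y) B = coords (co A.1) X B - coords (co A.1) Y B := by
    rw [coords, map_sub, LinearMap.sub_apply, Finsupp.sub_apply, coords, coords]
  rw [h]
  by_cases hB : B = A
  · rw [hB, x3, y3, sub_self]
    exact zero_mem_vInvZ
  · rw [sub_eq_add_neg]
    exact add_mem_vInvZ (x4 B hB).1 (neg_mem_vInvZ (y4 B hB).1)

/-! ## The example in rank one -/

lemma barQ_v_zpow_add (k : ℤ) : barQ (v ^ k + v ^ (-k)) = v ^ k + v ^ (-k) := by
  rw [map_add, map_zpow₀, map_zpow₀, barQ_v, inv_zpow', inv_zpow', neg_neg, add_comm]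

/-- The coefficient of the correction term is in `v⁻¹ ℤ[v⁻¹]`. -/
lemma neg_v_zpow_mul_qInt_mem_vInvZ {a p : ℤ} (ha : a ≤ -2) (hp : p ≤ 0) :
    -(v ^ (a + p + 1) * qInt (p + 1)) ∈ vInvZ := by
  rcases hp.eq_or_lt with rfl | hp
  · exact neg_mem_vInvZ (v_zpow_mul_qInt_mem_vInvZ 1 _ (by push_cast; omega))
  · obtain ⟨q, hq⟩ : ∃ q : ℕ, p + 1 = -(q : ℤ) := ⟨(-(p + 1)).toNat, by omega⟩
    rw [hq, qInt_neg, mul_neg, neg_neg]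
    exact v_zpow_mul_qInt_mem_vInvZ q _ (by omega)

lemma below_mat (wt : Weight 1) (i j : ℤ) : Below (mat wt i j) (mat wt (i + 1) (j + 1)) := by
  have h1 : Finset.Iic (0 : Fin 2) = {0} := rfl
  have h2 : Finset.Ici (1 : Fin 2) = {1} := rfl
  refine ⟨?_, ?_, fun a b hab => ?_, fun a b hab => ?_⟩
  · rw [ro_mat, ro_mat, add_smul, add_smul]
    abel
  · rw [co_mat, co_mat]
  · obtain ⟨rfl, rfl⟩ : a = 0 ∧ b = 1 := by omega
    simp [h1, h2, mat]
  · obtain ⟨rfl, rfl⟩ : b = 0 ∧ a = 1 := by omega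
    simp [h1, h2, mat]

/-- The element `E F^{(b+1)} 1_wt - [p+1] (v^k + v^{-k}) F^{(b)} 1_wt`, where `k` is the second
entry of `wt` and `[p+1]` is the bar-invariant quantum integer. -/
def exElement (b : ℕ) (p : ℤ) (wt : Weight 1) : U 1 :=
  E 0 (wt - ((b + 1 : ℕ) : ℤ) • root 0) * divF 0 (b + 1) wt
    - (qInt (p + 1) * (v ^ wt 1 + v ^ (-wt 1))) • divF 0 b wt

/-- Since `λ₁ - b = p + 1`, the product `E F^{(b+1)} 1_λ` has second coefficient `v^{-λ₂} [p+1]`.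
The bar-invariant correction cancels it and leaves the conjugate `v^{λ₂} [p+1]` with a minus sign.
-/
lemma coords_exElement (b : ℕ) {p : ℤ} {wt : Weight 1} (h0 : wt 0 = p + (b + 1 : ℕ)) :
    coords wt (exElement b p wt) = std (mat wt 1 (b + 1 : ℕ))
      + (-(v ^ wt 1 * qInt (p + 1))) • std (mat wt 0 b) := by
  have h1 := coords_divF wt b
  have h2 := coords_divF wt (b + 1)
  have h3 := act_E_std_mat wt 0 (b + 1 : ℕ)
  rw [zero_smul, add_zero, mul_zero, zero_sub, h0, add_sub_cancel_right, zero_add, qInt_one,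
    one_smul] at h3
  rw [coords] at h1 h2
  have h4 : ((b + 1 : ℕ) : ℤ) - 1 = b := by push_cast; ring
  rw [exElement, coords, map_sub, map_mul, map_smul, LinearMap.sub_apply, Module.End.mul_apply,
    LinearMap.smul_apply, h1, h2, h3, h4]
  have e : -(v ^ wt 1 * qInt (p + 1))
      = v ^ (-wt 1) * qInt (p + 1) - qInt (p + 1) * (v ^ wt 1 + v ^ (-wt 1)) := by ring
  rw [e, sub_smul]
  abel

lemma isBLM_exElement (b : ℕ) {a p : ℤ} (ha : a ≤ -2) (hp : p ≤ 0) {wt : Weight 1}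
    (h0 : wt 0 = p + (b + 1 : ℕ)) (h1 : wt 1 = a + p + 1) :
    IsBLM (exMatrix (b + 1) a p) (exElement b p wt) := by
  have hA : (exMatrix (b + 1) a p).1 = mat wt 1 (b + 1 : ℕ) := by
    simp only [exMatrix, mat, h0, h1]
    congr 1
    simp
  have hco : co (exMatrix (b + 1) a p).1 = wt := by rw [hA, co_mat]
  have hD := inTheta_mat wt le_rfl (Nat.cast_nonneg b : (0 : ℤ) ≤ b)
  have hne : (⟨_, hD⟩ : Theta 2) ≠ exMatrix (b + 1) a p := by
    intro h
    have := congrArg Subtype.val h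
    rw [hA] at this
    exact zero_ne_one (mat_inj this).1
  have hcoords : ∀ B : Theta 2, coords wt (exElement b p wt) B
      = (if exMatrix (b + 1) a p = B then 1 else 0)
        + (-(v ^ wt 1 * qInt (p + 1))) * if ⟨_, hD⟩ = B then 1 else 0 := by
    intro B
    rw [coords_exElement b h0, Finsupp.add_apply, Finsupp.smul_apply, ← hA, std_apply,
      std_apply ⟨_, hD⟩, smul_eq_mul]
  refine ⟨?_, ?_, ?_, fun B hB => ?_⟩
  · rw [hco, exElement, sub_mul, mul_assoc, smul_mul_assoc, divF, divF, smul_mul_assoc,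
      smul_mul_assoc, powF_mul_one, powF_mul_one]
  · rw [exElement, map_sub, map_mul, bar_smul, map_mul, barQ_v_zpow_add, barQ_qInt, bar_E,
      bar_divF, bar_divF]
  · rw [hco, hcoords, if_pos rfl, if_neg hne, mul_zero, add_zero]
  · rw [hco, hcoords, if_neg hB.symm, zero_add]
    split_ifs with h
    · subst h
      rw [mul_one, h1]
      refine ⟨neg_v_zpow_mul_qInt_mem_vInvZ ha hp, fun _ => ?_⟩
      rw [hA]
      exact_mod_cast below_mat wt 0 b
    · rw [mul_zero]
      exact ⟨zero_mem_vInvZ, fun h => (h rfl).elim⟩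

/-- With `k = λ₂`, the first term acts by `[λ₁ - λ₂ - b] = [-a]`. The correction is `[p+1+k] +
[p+1-k]`, whose second summand is also `[-a]`. What remains is `-[p+1+k] = [-a-2p-2]`. -/
lemma exElement_smul_hwVec (b : ℕ) {a p : ℤ} {wt : Weight 1}
    (h0 : wt 0 = p + (b + 1 : ℕ)) (h1 : wt 1 = a + p + 1) :
    exElement b p wt • hwVec wt
      = (v ^ (a + 2 * p + 3) * br (-a - 2 * p - 2)) • (divF 0 b wt • hwVec wt) := by
  have hvac : IsVacuum (wt 1) wt := fun i => by
    obtain rfl : i = 0 := Subsingleton.elim _ _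
    rfl
  have e1 : a + 2 * p + 3 = 1 - (-a - 2 * p - 2) := by ring
  have e2 : p + ((b + 1 : ℕ) : ℤ) - (a + p + 1) - b = -a := by push_cast; ring
  have e3 : p + 1 - (a + p + 1) = -a := by ring
  have e4 : p + 1 + (a + p + 1) = -(-a - 2 * p - 2) := by ring
  have key : qInt (-a - 2 * p - 2)
      = qInt (wt 0 - wt 1 - b) - qInt (p + 1) * (v ^ wt 1 + v ^ (-wt 1)) := by
    rw [qInt_mul_v_zpow_add, h0, h1, e2, e3, e4, qInt_neg (-a - 2 * p - 2)]
    ring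
  rw [exElement, sub_smul, E_mul_divF_smul_hwVec hvac, ← smul_assoc, ← smul_assoc, e1,
    v_zpow_mul_br, key, smul_hwVec, smul_hwVec, smul_hwVec, ← Submodule.Quotient.mk_sub]
  exact congrArg Submodule.Quotient.mk (sub_smul _ _ (divF 0 b wt)).symm

end
end QuantumGL

theorem mainTheorem12 :
    (∀ r : ℕ, 1 ≤ r → ∃ (wt : Weight r) (A : Theta (r + 1)) (C : U r),
      Dominant wt ∧ IsBLM A C ∧ C • hwVec wt ≠ 0 ∧ C • hwVec wt ∉ canonicalBasis wt) ∧
    (∀ (a : ℕ) (a₂₂ p : ℤ), 1 ≤ a → a₂₂ ≤ -2 → p ≤ 0 →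
      ∀ wt : Weight 1, wt = ![p + a, a₂₂ + p + 1] →
        Dominant wt ∧
        ∃ C : U 1, (∀ X : U 1, IsBLM (exMatrix a a₂₂ p) X ↔ X = C) ∧
          C • hwVec wt
            = (v ^ (a₂₂ + 2 * p + 3) * br (-a₂₂ - 2 * p - 2)) •
                (divF 0 (a - 1) wt • hwVec wt)) := by
  refine ⟨exists_isBLM_smul_hwVec_notMem, fun a a₂₂ p ha ha₂₂ hp wt hwt => ?_⟩
  obtain ⟨b, rfl⟩ := Nat.exists_eq_add_of_le' ha
  have h0 : wt 0 = p + (b + 1 : ℕ) := by rw [hwt]; rfl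
  have h1 : wt 1 = a₂₂ + p + 1 := by rw [hwt]; rfl
  have hC := isBLM_exElement b ha₂₂ hp h0 h1
  refine ⟨fun i => ?_, exElement b p wt,
    fun X => ⟨fun hX => hX.unique hC, fun hX => hX ▸ hC⟩, exElement_smul_hwVec b h0 h1⟩
  obtain rfl : i = 0 := Subsingleton.elim _ _
  change wt 1 ≤ wt 0
  rw [h0, h1]
  push_cast
  omega
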